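/- Let $\mathcal{A}$ be a finite alphabet with the discrete topology and let $\eta\colon\mathbb{Z}^2\to\mathcal{A}$. For $\vec u\in\mathbb{Z}^2$ let $(T^{\vec u}\eta)(\vec x)=\eta(\vec x+\vec u)$, and let $X_\eta\subseteq\mathcal{A}^{\mathbb{Z}^2}$ be the closure, in the product topology, of the orbit $\{T^{\vec u}\eta:\vec u\in\mathbb{Z}^2\}$. For a finite set $\mathcal{S}\subset\mathbb{Z}^2$ let $P_\eta(\mathcal{S})$ be the number of distinct restrictions $(T^{\vec u}\eta)|_{\mathcal{S}}$, $\vec u\in\mathbb{Z}^2$, and let $R_{n,3}=\{0,\dots,n-1\}\times\{0,1,2\}$. A line $\ell\subset\mathbb{R}^2$ is called nonexpansive for $\eta$ if for every $r\in\mathbb{R}$ there exist $f,g\in X_\eta$ with $f\neq g$ and $f(\vec u)=g(\vec u)$ for all $\vec u\in\mathbb{Z}^2$ whose Euclidean distance to $\ell$ satisfies $d(\vec u,\ell)<r$. This property is invariant under translations of $\ell$, and nonexpansive lines are counted up to translation, that is, only lines through the origin are counted. If there are exactly two nonexpansive lines for $\eta$, then $P_\eta(R_{n,3})>3n$ for all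 $n\in\mathbb{N}$. -/

import Mathlib

namespace Nivat

/-- The Euclidean plane. -/
abbrev Plane : Type := EuclideanSpace ℝ (Fin 2)

/-- The inclusion of `ℤ²` in the Euclidean plane. -/
noncomputable def toPlane (u : ℤ × ℤ) : Plane := !₂[(u.1 : ℝ), (u.2 : ℝ)]

/-- The translation action of `ℤ²` on colorings: `(T^u η)(x) = η(x + u)`. -/
def translate {A : Type*} (u : ℤ × ℤ) (η : ℤ × ℤ → A) : ℤ × ℤ → A :=
  fun x => η (x + u)

/-- The orbit of `η` under all translations. -/
def orbit {A : Type*} (η : ℤ × ℤ → A) : Set (ℤ × ℤ → A) :=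
  Set.range fun u : ℤ × ℤ => translate u η

/-- The orbit closure `X_η` in the product topology (`A` will carry the discrete topology). -/
def orbitClosure {A : Type*} [TopologicalSpace A] (η : ℤ × ℤ → A) : Set (ℤ × ℤ → A) :=
  closure (orbit η)

/-- The `S`-words of `η`: the restrictions to `S` of the translates of `η`. -/
def words {A : Type*} (η : ℤ × ℤ → A) (S : Finset (ℤ × ℤ)) : Set (S → A) :=
  Set.range fun (u : ℤ × ℤ) (x : S) => translate u η x

/-- The complexity `P_η(S)`: the number of distinct `S`-words of `η`. -/
noncomputable def complexity {A : Type*} (η : ℤ × ℤ → A) (S : Finset (ℤ × ℤ)) : ℕ :=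
  (words η S).ncard

/-- The rectangle `R_{n,k}` of width `n` and height `k`. -/
noncomputable def rectangle (n k : ℕ) : Finset (ℤ × ℤ) :=
  Finset.Ico (0 : ℤ) n ×ˢ Finset.Ico (0 : ℤ) k

/-- An (affine) line in the plane. -/
def IsLine (l : AffineSubspace ℝ Plane) : Prop :=
  (l : Set Plane).Nonempty ∧ Module.finrank ℝ l.direction = 1

/-- `l` is a nonexpansive line for `η`: it is a line, and for every `r` there are two distinct
elements of `X_η` that agree at all integer points at distance less than `r` from `l`. -/
def IsNonexpansiveLine {A : Type*} [TopologicalSpace A] (η : ℤ × ℤ → A)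
    (l : AffineSubspace ℝ Plane) : Prop :=
  IsLine l ∧ ∀ r : ℝ, ∃ f ∈ orbitClosure η, ∃ g ∈ orbitClosure η, f ≠ g ∧
    ∀ u : ℤ × ℤ, Metric.infDist (toPlane u) (l : Set Plane) < r → f u = g u

/-- The nonexpansive lines through the origin. As the property is invariant under translations of
the line, these represent the nonexpansive lines up to translation. -/
def nonexpansiveLines {A : Type*} [TopologicalSpace A] (η : ℤ × ℤ → A) :
    Set (AffineSubspace ℝ Plane) :=
  {l | IsNonexpansiveLine η l ∧ (0 : Plane) ∈ l}

end Nivat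

namespace Nivat

/-! ### Finite-state sequences and the Morse–Hedlund theorem -/

/-! Suppose the complexity of the `n` by 3 rectangle is at most `3n`, and code the alphabet by
integers to get `c : ℤ² → ℤ`. The claim is then a dichotomy (`periodic_or_three_directions`): either
`c` has a nonzero period, which leaves at most one nonexpansive line, or it has three nonexpansive
lines. The count two falls in the gap.

Low complexity gives a linear relation between the values of `c` at the points of the rectangle. A
Frobenius argument dilates the relation, and elimination in the dilated system yields a product of
difference operators that annihilates `c` (`exists_annihilates_of_relation`). In an annihilating
list of minimal length the vectors are pairwise nonparallel, because finite range lets parallel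
factors be merged. By minimality, dropping one factor `u` leaves a function that is not periodic
along any other factor (`MinAnnihilates.not_periodic`). It follows that every relation for `c` has
at least two support points on the face in the direction of each listed vector or its negative
(`MinAnnihilates.exists_face`). Three rows have room for only two nonparallel left edges, so, with
at most one horizontal direction, the list has at most three vectors.

The main tool is `exists_ray`. If two limits of translates of `c` agree to the left of a ray
parallel to `u`, and on the ray differ by a nonzero periodic function, then they are periodic near
the ray. Indeed, peeling a line off the rectangle leaves a shape with fewer ambiguous words than
there are points on the peeled line. All patterns read next to the ray are ambiguous, so
Morse–Hedlund applies, and the relation carries the periodicity to further columns.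

Lists of length 0 and 1 give a period. For length 2, two limits along `u` that agree on half of a
strip have a `v`-periodic difference; rays then make one limit periodic along `v`, contrary to
minimality. For length 3 the same argument gives periodicity on a sector only. Pushing back along
`u` turns the sector into a half-plane, and if `u` were expansive the periodicity would be global,
again contrary to minimality. Hence none of the three directions is expansive. -/

theorem periodic_of_deterministic {X : Type*} [Finite X] (s : ℕ → X)
    (h : ∀ i j, s i = s j → s (i + 1) = s (j + 1)) {N : ℕ} (hN : Nat.card X ≤ N) :
    ∀ i, N ≤ i → s (i + N.factorial) = s i := by
  classical
  have := Fintype.ofFinite X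
  have hshift : ∀ t i j, s i = s j → s (i + t) = s (j + t) := by
    intro t
    induction t with
    | zero => intro i j hij; simpa using hij
    | succ t ih => intro i j hij; exact h _ _ (ih i j hij)
  obtain ⟨a, ha, b, hb, hab, hs⟩ : ∃ a ∈ Finset.range (N + 1), ∃ b ∈ Finset.range (N + 1),
      a ≠ b ∧ s a = s b := by
    apply Finset.exists_ne_map_eq_of_card_lt_of_maps_to (t := Finset.univ)
    · rw [Finset.card_univ, Finset.card_range, ← Nat.card_eq_fintype_card]; omega
    · intro x _; simp
  wlog hlt : a < b generalizing a b
  · exact this b hb a ha hab.symm hs.symm (by omega)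
  obtain ⟨q, rfl⟩ : ∃ q, b = a + q := ⟨b - a, by omega⟩
  simp only [Finset.mem_range] at ha hb
  have hq : ∀ i, a ≤ i → s (i + q) = s i := by
    intro i hi
    have := hshift (i - a) _ _ hs
    rw [show a + (i - a) = i by omega, show a + q + (i - a) = i + q by omega] at this
    exact this.symm
  have hmul : ∀ k i, a ≤ i → s (i + q * k) = s i := by
    intro k
    induction k with
    | zero => intro i _; simp
    | succ k ih =>
      intro i hi
      rw [Nat.mul_succ, ← add_assoc, hq _ (by omega), ih i hi]
  intro i hi
  -- The factorial absorbs the unknown period `q ≤ N`, so period and preperiod depend on `N` alone;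
  -- `column_periodic` needs this uniformity.
  obtain ⟨k, hk⟩ : q ∣ N.factorial := Nat.dvd_factorial (by omega) (by omega)
  rw [hk]
  exact hmul k i (by omega)

theorem int_periodic_of_deterministic {X : Type*} [Finite X] (s : ℤ → X)
    (h : ∀ i j, s i = s j → s (i + 1) = s (j + 1)) :
    ∃ q : ℕ, 0 < q ∧ ∀ i, s (i + q) = s i := by
  refine ⟨(Nat.card X).factorial, Nat.factorial_pos _, fun i => ?_⟩
  -- Starting `Nat.card X` steps before `i` puts `i` past the preperiod.
  have := periodic_of_deterministic (fun k : ℕ => s (i - Nat.card X + k))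
    (fun a b hab => by
      have := h _ _ hab
      push_cast
      simpa only [add_assoc] using this) le_rfl (Nat.card X) le_rfl
  push_cast at this
  rw [show i - (Nat.card X : ℤ) + (Nat.card X + ((Nat.card X).factorial : ℤ))
    = i + ((Nat.card X).factorial : ℤ) by ring,
    show i - (Nat.card X : ℤ) + Nat.card X = i by ring] at this
  exact this

/-- The word of length `t` at position `i`. -/
def wordAt {X : Type*} (Y : ℕ → X) (t i : ℕ) : Fin t → X := fun k => Y (i + k)

theorem wordAt_castSucc {X : Type*} (Y : ℕ → X) (t i : ℕ) :
    (fun k : Fin t => wordAt Y (t + 1) i k.castSucc) = wordAt Y t i := by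
  funext k; simp [wordAt]

/-- The number of words is at least 1 at length 0 and cannot increase strictly up to length `s`.
Where it stalls, each word determines the next letter. -/
theorem morse_hedlund {X : Type*} (Y : ℕ → X) (s : ℕ)
    (hfin : (Set.range (wordAt Y s)).Finite) (hcard : (Set.range (wordAt Y s)).ncard ≤ s) :
    ∀ i, s ≤ i → Y (i + s.factorial) = Y i := by
  have hres : ∀ t, (fun w : Fin (t + 1) → X => fun k : Fin t => w k.castSucc) ''
      Set.range (wordAt Y (t + 1)) = Set.range (wordAt Y t) := by
    intro t
    rw [← Set.range_comp]
    congr 1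
  have hdown : ∀ k t, t + k = s → (Set.range (wordAt Y t)).Finite ∧
      (Set.range (wordAt Y t)).ncard ≤ s := by
    intro k
    induction k with
    | zero => intro t ht; obtain rfl : t = s := by omega
              exact ⟨hfin, hcard⟩
    | succ k ih =>
      intro t ht
      obtain ⟨h1, h2⟩ := ih (t + 1) (by omega)
      rw [← hres t]
      exact ⟨h1.image _, (Set.ncard_image_le h1).trans h2⟩
  have hfin' : ∀ t, t ≤ s → (Set.range (wordAt Y t)).Finite :=
    fun t ht => (hdown (s - t) t (by omega)).1
  obtain ⟨t, hts, ht⟩ : ∃ t, t < s ∧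
      (Set.range (wordAt Y (t + 1))).ncard ≤ (Set.range (wordAt Y t)).ncard := by
    by_contra! hcon
    have : ∀ t, t ≤ s → t + 1 ≤ (Set.range (wordAt Y t)).ncard := by
      intro t
      induction t with
      | zero =>
        intro _
        exact Set.ncard_pos (hfin' 0 (by omega)) |>.2 ⟨_, 0, rfl⟩
      | succ t ih =>
        intro ht
        have := hcon t (by omega)
        have := ih (by omega)
        omega
    have := this s le_rfl
    omega
  have hinj : Set.InjOn (fun w : Fin (t + 1) → X => fun k : Fin t => w k.castSucc)
      (Set.range (wordAt Y (t + 1))) := by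
    apply Set.injOn_of_ncard_image_eq _ (hfin' (t + 1) (by omega))
    apply le_antisymm (Set.ncard_image_le (hfin' (t + 1) (by omega)))
    rw [hres t]
    exact ht
  have hdet : ∀ i j, wordAt Y t i = wordAt Y t j →
      wordAt Y (t + 1) i = wordAt Y (t + 1) j := by
    intro i j hij
    apply hinj ⟨i, rfl⟩ ⟨j, rfl⟩
    simp only [wordAt_castSucc, hij]
  have : Finite (Set.range (wordAt Y t)) := hfin' t hts.le
  intro i hi
  have hper := periodic_of_deterministic
    (fun i => (⟨wordAt Y t i, i, rfl⟩ : Set.range (wordAt Y t)))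
    (fun i j hij => by
      have h1 : wordAt Y t i = wordAt Y t j := congrArg Subtype.val hij
      have h2 := hdet i j h1
      apply Subtype.ext
      funext k
      have := congrFun h2 k.succ
      simp only [wordAt, Fin.val_succ] at this ⊢
      rw [show i + 1 + (k : ℕ) = i + (k + 1) by ring,
        show j + 1 + (k : ℕ) = j + (k + 1) by ring]
      exact this)
    (N := s) (by
      rw [Nat.card_coe_set_eq]
      exact (hdown (s - t) t (by omega)).2) i hi
  have h2 := hdet _ _ (congrArg Subtype.val hper)
  have := congrFun h2 0
  simpa [wordAt] using this

/-! ### Limits of finite-valued functions -/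

/-- Compactness: take pointwise limits along a nonprincipal ultrafilter. The freedom in `k₀` lets
the limit inherit properties that hold on regions growing with `k`. -/
theorem exists_limit {ι : Type*} (F : ℕ → ι → ℤ) {S : Set ℤ} (hS : S.Finite)
    (hF : ∀ k x, F k x ∈ S) :
    ∃ f : ι → ℤ, ∀ B : Finset ι, ∀ k₀ : ℕ, ∃ k, k₀ ≤ k ∧ ∀ x ∈ B, f x = F k x := by
  have h1 : ∀ x, ∃ a, ∀ᶠ k in (Filter.hyperfilter ℕ : Filter ℕ), F k x = a := by
    intro x
    have : ∀ᶠ k in (Filter.hyperfilter ℕ : Filter ℕ), ∃ a ∈ S, F k x = a :=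
      Filter.Eventually.of_forall fun k => ⟨_, hF k x, rfl⟩
    have h2 : (⋃ a ∈ S, {k | F k x = a}) ∈ Filter.hyperfilter ℕ := by
      refine Filter.mem_of_superset this ?_
      rintro k ⟨a, ha, hk⟩
      simp only [Set.mem_iUnion]
      exact ⟨a, ha, hk⟩
    rw [Ultrafilter.finite_biUnion_mem_iff hS] at h2
    obtain ⟨a, -, ha⟩ := h2
    exact ⟨a, ha⟩
  choose f hf using h1
  refine ⟨f, fun B k₀ => ?_⟩
  have h3 : ∀ᶠ k in (Filter.hyperfilter ℕ : Filter ℕ), ∀ x ∈ B, F k x = f x :=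
    (Filter.eventually_all_finset B).2 fun x _ => hf x
  have h4 : ∀ᶠ k in (Filter.hyperfilter ℕ : Filter ℕ), k₀ ≤ k := by
    have : ∀ᶠ k in Filter.cofinite, k₀ ≤ k := by
      rw [Nat.cofinite_eq_atTop]; exact Filter.eventually_ge_atTop k₀
    exact Filter.hyperfilter_le_cofinite this
  obtain ⟨k, hk1, hk2⟩ := (h3.and h4).exists
  exact ⟨k, hk2, fun x hx => (hk1 x hx).symm⟩

/-- The functions all of whose finite patterns occur in `c`. -/
def limits (c : ℤ × ℤ → ℤ) : Set (ℤ × ℤ → ℤ) :=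
  {f | ∀ B : Finset (ℤ × ℤ), ∃ u, ∀ x ∈ B, f x = c (x + u)}

theorem mem_limits_translate {c f : ℤ × ℤ → ℤ} (hf : f ∈ limits c) (u : ℤ × ℤ) :
    (fun x => f (x + u)) ∈ limits c := by
  intro B
  obtain ⟨v, hv⟩ := hf (B.image (· + u))
  refine ⟨u + v, fun x hx => ?_⟩
  change f (x + u) = _
  rw [hv (x + u) (Finset.mem_image_of_mem _ hx), add_assoc]

theorem limits_trans {c f g : ℤ × ℤ → ℤ} (hf : f ∈ limits c) (hg : g ∈ limits f) :
    g ∈ limits c := by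
  intro B
  obtain ⟨u, hu⟩ := hg B
  obtain ⟨v, hv⟩ := hf (B.image (· + u))
  refine ⟨u + v, fun x hx => ?_⟩
  rw [hu x hx, hv (x + u) (Finset.mem_image_of_mem _ hx), add_assoc]

theorem range_subset_of_mem_limits {c f : ℤ × ℤ → ℤ} (hf : f ∈ limits c) (x : ℤ × ℤ) :
    f x ∈ Set.range c := by
  obtain ⟨u, hu⟩ := hf {x}
  exact ⟨x + u, (hu x (by simp)).symm⟩

/-! ### Difference operators -/

/-- The determinant of two integer vectors. -/
def det (u v : ℤ × ℤ) : ℤ := u.1 * v.2 - u.2 * v.1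

theorem det_add_left (u v w : ℤ × ℤ) : det (u + v) w = det u w + det v w := by
  simp [det]; ring

theorem det_add_right (u v w : ℤ × ℤ) : det u (v + w) = det u v + det u w := by
  simp [det]; ring

theorem det_sub_left (u v w : ℤ × ℤ) : det (u - v) w = det u w - det v w := by
  simp [det]; ring

theorem det_sub_right (u v w : ℤ × ℤ) : det u (v - w) = det u v - det u w := by
  simp [det]; ring

theorem det_smul_left (k : ℤ) (u v : ℤ × ℤ) : det (k • u) v = k * det u v := by
  simp [det]; ring

theorem det_smul_right (k : ℤ) (u v : ℤ × ℤ) : det u (k • v) = k * det u v := by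
  simp [det]; ring

theorem det_neg_left (u v : ℤ × ℤ) : det (-u) v = -det u v := by
  simp [det]; ring

theorem det_neg_right (u v : ℤ × ℤ) : det u (-v) = -det u v := by
  simp [det]; ring

theorem det_self (u : ℤ × ℤ) : det u u = 0 := by simp [det]; ring

theorem det_swap (u v : ℤ × ℤ) : det v u = -det u v := by simp [det]; ring

/-- The difference operator `D_u f (x) = f (x + u) - f x`. -/
def diffBy (u : ℤ × ℤ) (f : ℤ × ℤ → ℤ) : ℤ × ℤ → ℤ := fun x => f (x + u) - f x

/-- The composition of the difference operators of a list of vectors. -/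
def diffList (L : List (ℤ × ℤ)) (f : ℤ × ℤ → ℤ) : ℤ × ℤ → ℤ := L.foldr diffBy f

@[simp] theorem diffList_nil (f : ℤ × ℤ → ℤ) : diffList [] f = f := rfl

@[simp] theorem diffList_cons (u : ℤ × ℤ) (L : List (ℤ × ℤ)) (f : ℤ × ℤ → ℤ) :
    diffList (u :: L) f = diffBy u (diffList L f) := rfl

theorem diffBy_comm (u v : ℤ × ℤ) (f : ℤ × ℤ → ℤ) :
    diffBy u (diffBy v f) = diffBy v (diffBy u f) := by
  funext x
  simp only [diffBy]
  rw [add_right_comm x u v]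
  ring

theorem diffList_diffBy (u : ℤ × ℤ) (L : List (ℤ × ℤ)) (f : ℤ × ℤ → ℤ) :
    diffList L (diffBy u f) = diffBy u (diffList L f) := by
  induction L with
  | nil => rfl
  | cons v L ih => simp only [diffList_cons, ih, diffBy_comm u v]

theorem diffList_perm {L L' : List (ℤ × ℤ)} (h : L.Perm L') (f : ℤ × ℤ → ℤ) :
    diffList L f = diffList L' f := by
  induction h with
  | nil => rfl
  | cons u _ ih => simp only [diffList_cons, ih]
  | swap u v L => simp only [diffList_cons, diffBy_comm u v]
  | trans _ _ ih1 ih2 => rw [ih1, ih2]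

theorem diffList_zero (L : List (ℤ × ℤ)) : diffList L (fun _ => 0) = fun _ => 0 := by
  induction L with
  | nil => rfl
  | cons u L ih => rw [diffList_cons, ih]; funext x; simp [diffBy]

theorem diffList_sub (L : List (ℤ × ℤ)) (f g : ℤ × ℤ → ℤ) :
    diffList L (fun x => f x - g x) = fun x => diffList L f x - diffList L g x := by
  induction L with
  | nil => rfl
  | cons u L ih => rw [diffList_cons, ih]; funext x; simp only [diffBy, diffList_cons]; ring

theorem diffList_translate (L : List (ℤ × ℤ)) (f : ℤ × ℤ → ℤ) (u : ℤ × ℤ) :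
    diffList L (fun x => f (x + u)) = fun x => diffList L f (x + u) := by
  induction L with
  | nil => rfl
  | cons v L ih =>
    rw [diffList_cons, ih]; funext x; simp only [diffBy, diffList_cons, add_right_comm x v u]

/-- `diffList L f x` depends only on the values of `f` on a finite set. -/
theorem diffList_local (L : List (ℤ × ℤ)) (x : ℤ × ℤ) :
    ∃ B : Finset (ℤ × ℤ), ∀ f g : ℤ × ℤ → ℤ, (∀ y ∈ B, f y = g y) →
      diffList L f x = diffList L g x := by
  induction L generalizing x with
  | nil => exact ⟨{x}, fun f g h => h x (by simp)⟩
  | cons u L ih =>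
    obtain ⟨B₁, h₁⟩ := ih x
    obtain ⟨B₂, h₂⟩ := ih (x + u)
    refine ⟨B₁ ∪ B₂, fun f g h => ?_⟩
    simp only [diffList_cons, diffBy]
    rw [h₁ f g fun y hy => h y (Finset.mem_union_left _ hy),
      h₂ f g fun y hy => h y (Finset.mem_union_right _ hy)]

theorem diffBy_eq_zero_iff {u : ℤ × ℤ} {f : ℤ × ℤ → ℤ} :
    (diffBy u f = fun _ => 0) ↔ ∀ x, f (x + u) = f x := by
  simp only [funext_iff, diffBy, sub_eq_zero]

theorem periodic_zsmul {u : ℤ × ℤ} {f : ℤ × ℤ → ℤ} (h : ∀ x, f (x + u) = f x) (k : ℤ) :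
    ∀ x, f (x + k • u) = f x := by
  induction k using Int.induction_on with
  | zero => simp
  | succ k ih => intro x; rw [add_smul, one_smul, ← add_assoc, h, ih]
  | pred k ih =>
    intro x
    rw [sub_smul, one_smul, ← h, ← ih x]
    congr 1
    abel

theorem finite_range_diffBy {f : ℤ × ℤ → ℤ} (hf : (Set.range f).Finite) (u : ℤ × ℤ) :
    (Set.range (diffBy u f)).Finite := by
  refine (hf.image2 (fun a b => a - b) hf).subset ?_
  rintro _ ⟨x, rfl⟩
  exact ⟨_, ⟨x + u, rfl⟩, _, ⟨x, rfl⟩, rfl⟩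

theorem finite_range_diffList {f : ℤ × ℤ → ℤ} (hf : (Set.range f).Finite) (L : List (ℤ × ℤ)) :
    (Set.range (diffList L f)).Finite := by
  induction L with
  | nil => exact hf
  | cons u L ih => exact finite_range_diffBy ih u

/-- A function killed by `D_w ^ 2` with finite range is `w`-periodic. -/
theorem periodic_of_diffBy_diffBy {d : ℤ × ℤ → ℤ} (hd : (Set.range d).Finite) {w : ℤ × ℤ}
    (h : diffBy w (diffBy w d) = fun _ => 0) : diffBy w d = fun _ => 0 := by
  funext x
  have h1 := periodic_zsmul (diffBy_eq_zero_iff.1 h)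
  -- Along `w` the function is an arithmetic progression, and finite range forces its slope to
  -- vanish.
  have h2 : ∀ n : ℕ, d (x + (n : ℤ) • w) = d x + n * diffBy w d x := by
    intro n
    induction n with
    | zero => simp
    | succ n ih =>
      have := h1 n x
      rw [← this] at ih ⊢
      simp only [diffBy] at ih ⊢
      push_cast
      rw [add_smul, one_smul, ← add_assoc]
      linarith
  by_contra hne
  have hinj : Function.Injective fun n : ℕ => d (x + (n : ℤ) • w) := by
    intro a b hab
    simp only [h2] at hab
    have : ((a : ℤ) - b) * diffBy w d x = 0 := by linarith
    rcases mul_eq_zero.1 this with h | h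
    · omega
    · exact absurd h hne
  exact Set.infinite_range_of_injective hinj (hd.subset (by rintro _ ⟨n, rfl⟩; exact ⟨_, rfl⟩))

/-! ### Propagation of zeros -/

theorem eq_zero_of_periodic_of_strip {G : ℤ × ℤ → ℤ} (l : ℤ × ℤ →+ ℤ) {a : ℤ × ℤ} {s : ℤ}
    (hG : ∀ x, G (x + a) = G x) (ha : l a ≠ 0)
    (h0 : ∀ x, s ≤ l x → l x < s + |l a| → G x = 0) : ∀ x, G x = 0 := by
  intro x
  have h1 := periodic_zsmul hG
  rw [← h1 (-((l x - s) / l a)) x]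
  have hk := Int.emod_add_mul_ediv (l x - s) (l a)
  have h2 := Int.emod_nonneg (l x - s) ha
  have h3 := Int.emod_lt_abs (l x - s) ha
  apply h0 <;>
  · rw [map_add, map_zsmul, smul_eq_mul]
    linarith

/-- `det u ·` as an additive homomorphism. -/
def detHom (u : ℤ × ℤ) : ℤ × ℤ →+ ℤ := AddMonoidHom.mk' (det u) (det_add_right u)

@[simp] theorem detHom_apply (u x : ℤ × ℤ) : detHom u x = det u x := rfl

/-! ### Linear relations and annihilation by difference operators -/

theorem words_finite {c : ℤ × ℤ → ℤ} (hc : (Set.range c).Finite) (B : Finset (ℤ × ℤ)) :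
    (words c B).Finite := by
  refine (Set.Finite.pi' (fun _ : B => hc)).subset ?_
  rintro _ ⟨u, rfl⟩ x
  exact ⟨_, rfl⟩

/-- The `|B|` coordinates and the constant 1 are `|B| + 1` functions on a set of at most `|B|`
words, hence dependent. The coefficient of 1 becomes `K`. -/
theorem exists_relation {c : ℤ × ℤ → ℤ} (hc : (Set.range c).Finite) {B : Finset (ℤ × ℤ)}
    (h : complexity c B ≤ B.card) :
    ∃ (F : ℤ × ℤ → ℤ) (K : ℤ), (∃ v ∈ B, F v ≠ 0) ∧ ∀ x, ∑ v ∈ B, F v * c (x + v) = K := by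
  classical
  have := (words_finite hc B).fintype
  let w : Option B → (words c B → ℤ) := fun o p => o.elim 1 (fun v => p.1 v)
  have hdep : ¬ LinearIndependent ℤ w := by
    intro hli
    have h1 := hli.fintype_card_le_finrank
    rw [Module.finrank_fintype_fun_eq_card, Fintype.card_option, Fintype.card_coe,
      ← Nat.card_eq_fintype_card, Nat.card_coe_set_eq] at h1
    unfold complexity at h
    omega
  obtain ⟨g, hg, o, ho⟩ := Fintype.not_linearIndependent_iff.1 hdep
  have hrel : ∀ x, g none + ∑ v : B, g (some v) * c (x + v) = 0 := by
    intro x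
    have := congrFun hg ⟨_, x, rfl⟩
    rw [Finset.sum_apply, Fintype.sum_option] at this
    simpa [w, translate, add_comm] using this
  refine ⟨fun v => if hv : v ∈ B then g (some ⟨v, hv⟩) else 0, - g none, ?_, fun x => ?_⟩
  · by_contra! hcon
    have h0 : ∀ v : B, g (some v) = 0 := by
      intro v
      have := hcon v v.2
      simpa using this
    have h1 := hrel 0
    simp only [h0, zero_mul, Finset.sum_const_zero, add_zero] at h1
    rcases o with _ | v
    · exact ho h1
    · exact ho (h0 v)
  · rw [← Finset.sum_coe_sort]
    have := hrel x
    simp only [Finset.coe_mem, dite_true, Subtype.coe_eta]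
    linarith

/-- The Frobenius argument: a relation can be dilated by a prime `p`, modulo `p`. -/
theorem dvd_sum_of_relation {ι : Type*} {p : ℕ} (hp : p.Prime) {c : ℤ × ℤ → ℤ} (B : Finset ι)
    (F : ι → ℤ) (pos : ι → ℤ × ℤ) (h : ∀ x, ∑ v ∈ B, F v * c (x + pos v) = 0) (x : ℤ × ℤ) :
    (p : ℤ) ∣ ∑ v ∈ B, F v * c (x + p • pos v) := by
  have := Fact.mk hp
  let S : ℤ × ℤ → Module.End (ZMod p) (ℤ × ℤ → ZMod p) :=
    fun v => LinearMap.funLeft (ZMod p) (ZMod p) (· + v)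
  have hS : ∀ v w, S v * S w = S (v + w) := by
    intro v w
    ext f x
    simp [S, LinearMap.funLeft_apply, add_assoc]
  have hS0 : S 0 = 1 := by
    ext f x
    simp [S, LinearMap.funLeft_apply]
  have hpow : ∀ (n : ℕ) v, S v ^ n = S (n • v) := by
    intro n v
    induction n with
    | zero => simp [hS0]
    | succ n ih => rw [pow_succ, ih, hS, succ_nsmul]
  have hcomm : ∀ v w, Commute (S v) (S w) := fun v w => by
    rw [Commute, SemiconjBy, hS, hS, add_comm]
  have : CharP (Module.End (ZMod p) (ℤ × ℤ → ZMod p)) p :=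
    charP_of_injective_algebraMap (algebraMap (ZMod p) _).injective p
  have hfrob : ∀ C : Finset ι, (∑ v ∈ C, (F v : ZMod p) • S (pos v)) ^ p
      = ∑ v ∈ C, (F v : ZMod p) • S (p • pos v) := by
    classical
    intro C
    induction C using Finset.induction_on with
    | empty => simp [hp.ne_zero]
    | insert v C hv ih =>
      rw [Finset.sum_insert hv, Finset.sum_insert hv, add_pow_char_of_commute, ih, smul_pow,
        ZMod.pow_card, hpow]
      exact Commute.sum_right _ _ _ fun w _ => ((hcomm _ _).smul_left _).smul_right _
  let cp : ℤ × ℤ → ZMod p := fun x => (c x : ZMod p)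
  have hact : ∀ (q : ι → ℤ × ℤ) (y : ℤ × ℤ),
      (∑ v ∈ B, (F v : ZMod p) • S (q v)) cp y = ((∑ v ∈ B, F v * c (y + q v) : ℤ) : ZMod p) := by
    intro q y
    rw [LinearMap.sum_apply, Finset.sum_apply]
    push_cast
    rfl
  rw [← ZMod.intCast_zmod_eq_zero_iff_dvd, ← hact, ← hfrob]
  have h0 : (∑ v ∈ B, (F v : ZMod p) • S (pos v)) cp = 0 := by
    funext y
    rw [hact, h]
    simp
  rw [← pow_sub_one_mul hp.ne_zero, Module.End.mul_apply, h0, map_zero]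
  rfl

/-- Dilating by a prime `p` keeps the sum divisible by `p`; when `p` exceeds the a priori bound `L`
of the sum, it is zero. Every prime factor of `1 + i * L!` exceeds `L`, so these dilations can be
done one prime at a time. -/
theorem exists_dilation {c : ℤ × ℤ → ℤ} (hc : (Set.range c).Finite) (B : Finset (ℤ × ℤ))
    (F : ℤ × ℤ → ℤ) (h : ∀ x, ∑ v ∈ B, F v * c (x + v) = 0) :
    ∃ r : ℕ, 0 < r ∧ ∀ i : ℕ, ∀ x, ∑ v ∈ B, F v * c (x + (1 + i * r) • v) = 0 := by
  obtain ⟨N, hN⟩ : ∃ N : ℕ, ∀ x, |c x| ≤ N := by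
    obtain ⟨M, hM⟩ := (hc.image fun a => a.natAbs).bddAbove
    refine ⟨M, fun x => ?_⟩
    have : (c x).natAbs ≤ M := hM ⟨c x, ⟨x, rfl⟩, rfl⟩
    rw [Int.abs_eq_natAbs]
    exact_mod_cast this
  let L : ℕ := ∑ v ∈ B, (F v).natAbs * N
  have hbound : ∀ (q : ℤ × ℤ → ℤ × ℤ) x, |∑ v ∈ B, F v * c (x + q v)| ≤ L := by
    intro q x
    refine (Finset.abs_sum_le_sum_abs _ _).trans ?_
    push_cast [L]
    refine Finset.sum_le_sum fun v _ => ?_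
    rw [abs_mul]
    have := hN (x + q v)
    exact mul_le_mul_of_nonneg_left this (abs_nonneg _)
  have key : ∀ n : ℕ, (∀ p : ℕ, p.Prime → p ∣ n → L < p) → n ≠ 0 →
      ∀ x, ∑ v ∈ B, F v * c (x + n • v) = 0 := by
    intro n
    induction n using induction_on_primes with
    | zero => intro _ h0; exact absurd rfl h0
    | one => intro _ _ x; simpa using h x
    | prime_mul p a hp ih =>
      intro hdiv hne x
      have h1 := ih (fun q hq hqa => hdiv q hq (hqa.mul_left p)) (right_ne_zero_of_mul hne)
      have h2 := dvd_sum_of_relation hp B F (fun v => a • v) h1 x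
      simp only [← mul_smul] at h2
      refine Int.eq_zero_of_abs_lt_dvd h2 ?_
      have h3 := hbound (fun v => (p * a) • v) x
      have h4 := hdiv p hp (dvd_mul_right p a)
      refine h3.trans_lt ?_
      exact_mod_cast h4
  refine ⟨L.factorial, Nat.factorial_pos _, fun i => key _ (fun p hp hpd => ?_) (by omega)⟩
  by_contra! hle
  have h1 : p ∣ i * L.factorial := (Nat.dvd_factorial hp.pos hle).mul_left i
  have h2 := (Nat.dvd_add_left h1).1 hpd
  exact hp.one_lt.ne' (Nat.dvd_one.1 h2)

/-- Elimination in a Vandermonde system of translations. -/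
theorem exists_diffList_of_vandermonde {ι : Type*} [DecidableEq ι] (T : ι → ℤ × ℤ) (v₀ : ι) :
    ∀ (n : ℕ) (s : Finset ι) (y : ι → ℤ × ℤ → ℤ), s.card = n →
      (∀ (i : ℕ) x, ∑ v ∈ s, y v (x + i • T v) = 0) → v₀ ∈ s →
      ∃ L : List (ℤ × ℤ), (∀ u ∈ L, ∃ w, w ≠ v₀ ∧ u = T v₀ - T w) ∧
        diffList L (y v₀) = fun _ => 0 := by
  intro n
  induction n with
  | zero =>
    intro s y hs _ hv
    rw [Finset.card_eq_zero] at hs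
    simp [hs] at hv
  | succ n ih =>
    intro s y hs h hv
    by_cases hsing : ∃ w ∈ s, w ≠ v₀
    · obtain ⟨w, hw, hne⟩ := hsing
      -- Equation `i + 1` at `x` minus equation `i` at `x + T w` eliminates the term of `w` and
      -- keeps the shape of the system.
      obtain ⟨L, hL, hzero⟩ := ih (s.erase w) (fun v x => y v (x + T v) - y v (x + T w))
        (by rw [Finset.card_erase_of_mem hw]; omega) (by
          intro i x
          have h1 := h (i + 1) x
          have h2 := h i (x + T w)
          rw [← Finset.add_sum_erase s _ hw] at h1 h2
          rw [Finset.sum_sub_distrib]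
          have e1 : ∀ v, x + (i + 1) • T v = x + i • T v + T v := fun v => by
            rw [succ_nsmul, add_assoc]
          have e2 : ∀ v, x + T w + i • T v = x + i • T v + T w := fun v => add_right_comm _ _ _
          simp only [e1, e2] at h1 h2
          linarith) (Finset.mem_erase.2 ⟨hne.symm, hv⟩)
      refine ⟨(T v₀ - T w) :: L, ?_, ?_⟩
      · intro u hu
        rcases List.mem_cons.1 hu with rfl | hu
        · exact ⟨w, hne, rfl⟩
        · exact hL u hu
      · have e : (fun x => y v₀ (x + T v₀) - y v₀ (x + T w))
            = fun x => diffBy (T v₀ - T w) (y v₀) (x + T w) := by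
          funext x
          simp only [diffBy]
          congr 2
          abel
        have h3 : diffList L (fun x => y v₀ (x + T v₀) - y v₀ (x + T w)) = fun _ => 0 := hzero
        rw [e, diffList_translate] at h3
        rw [diffList_cons, ← diffList_diffBy]
        funext x
        have := congrFun h3 (x - T w)
        simpa using this
    · push Not at hsing
      refine ⟨[], by simp, ?_⟩
      have hs1 : s = {v₀} := Finset.eq_singleton_iff_unique_mem.2 ⟨hv, hsing⟩
      funext x
      have := h 0 x
      simpa [hs1] using this

theorem diffList_mul_translate (L : List (ℤ × ℤ)) (a : ℤ) (v : ℤ × ℤ) (c : ℤ × ℤ → ℤ) :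
    diffList L (fun x => a * c (x + v)) = fun x => a * diffList L c (x + v) := by
  induction L with
  | nil => rfl
  | cons u L ih =>
    rw [diffList_cons, ih]
    funext x
    simp only [diffBy, diffList_cons, add_right_comm x u v]
    ring

/-- `L` is a list of nonzero vectors whose difference operators annihilate `c`. -/
def Annihilates (L : List (ℤ × ℤ)) (c : ℤ × ℤ → ℤ) : Prop :=
  (∀ u ∈ L, u ≠ 0) ∧ diffList L c = fun _ => 0

/-- One difference along `(1, 0)` removes the constant `K`. The dilations by `1 + i r` then form a
Vandermonde system with translations `r • v`, and solving it for `v₀` leaves differences along the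
nonzero vectors `r • (v₀ - w)`. -/
theorem exists_annihilates_of_relation {c : ℤ × ℤ → ℤ} (hc : (Set.range c).Finite)
    {B : Finset (ℤ × ℤ)} {F : ℤ × ℤ → ℤ} {K : ℤ} {v₀ : ℤ × ℤ} (hv₀ : v₀ ∈ B) (hF : F v₀ ≠ 0)
    (h : ∀ x, ∑ v ∈ B, F v * c (x + v) = K) : ∃ L, Annihilates L c := by
  have hd : ∀ x, ∑ v ∈ B, F v * diffBy (1, 0) c (x + v) = 0 := by
    intro x
    have h1 := h x
    have h2 := h (x + (1, 0))
    simp only [diffBy, mul_sub, Finset.sum_sub_distrib]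
    simp only [add_right_comm x (1, 0)] at h2
    rw [h1, h2, sub_self]
  obtain ⟨r, hr, hdil⟩ := exists_dilation (finite_range_diffBy hc _) B F hd
  obtain ⟨L, hL, hzero⟩ := exists_diffList_of_vandermonde (fun v : ℤ × ℤ => r • v) v₀ B.card B
    (fun v x => F v * diffBy (1, 0) c (x + v)) rfl (by
      intro i x
      refine Eq.trans ?_ (hdil i x)
      refine Finset.sum_congr rfl fun v _ => ?_
      congr 2
      rw [add_smul, one_smul, mul_smul, smul_comm i r v]
      abel) hv₀
  refine ⟨L ++ [(1, 0)], ?_, ?_⟩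
  · intro u hu
    rcases List.mem_append.1 hu with hu | hu
    · obtain ⟨w, hw, rfl⟩ := hL u hu
      rw [← smul_sub]
      exact smul_ne_zero hr.ne' (sub_ne_zero.2 hw.symm)
    · rw [List.mem_singleton.1 hu]
      decide
  · rw [diffList_mul_translate] at hzero
    have : diffList (L ++ [(1, 0)]) c = diffList L (diffBy (1, 0) c) := by
      simp [diffList, List.foldr_append]
    rw [this]
    funext x
    have h1 := congrFun hzero (x - v₀)
    simpa [hF] using h1

/-! ### Merging parallel factors and minimal annihilating lists. -/

theorem exists_parallel_multiple {u v : ℤ × ℤ} (hu : u ≠ 0) (hv : v ≠ 0) (h : det u v = 0) :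
    ∃ p q : ℤ, p ≠ 0 ∧ q ≠ 0 ∧ p • u = q • v := by
  obtain ⟨a, b⟩ := u
  obtain ⟨x, y⟩ := v
  simp only [det, ne_eq, Prod.mk_eq_zero, not_and_or] at *
  by_cases ha : a = 0
  · subst ha
    have hb : b ≠ 0 := by simpa using hu
    have hx : x = 0 := by simpa [hb] using h
    subst hx
    have hy : y ≠ 0 := by simpa using hv
    exact ⟨y, b, hy, hb, by simp [mul_comm]⟩
  · have hx : x ≠ 0 := by
      rintro rfl
      simp [ha] at h
      simp [h] at hv
    refine ⟨x, a, hx, ha, ?_⟩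
    simp only [Prod.smul_mk, smul_eq_mul, Prod.mk.injEq]
    constructor
    · ring
    · linarith

theorem diffBy_zsmul_eq_zero {u : ℤ × ℤ} {f : ℤ × ℤ → ℤ} (h : diffBy u f = fun _ => 0) (k : ℤ) :
    diffBy (k • u) f = fun _ => 0 :=
  diffBy_eq_zero_iff.2 (periodic_zsmul (diffBy_eq_zero_iff.1 h) k)

theorem Annihilates.perm {L L' : List (ℤ × ℤ)} {c : ℤ × ℤ → ℤ} (h : Annihilates L c)
    (hp : L.Perm L') : Annihilates L' c :=
  ⟨fun u hu => h.1 u (hp.mem_iff.2 hu), by rw [← diffList_perm hp]; exact h.2⟩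

/-- Both factors may be replaced by a common multiple `w`; a square `D_w ^ 2` that kills a function
of finite range may then be replaced by `D_w`. -/
theorem Annihilates.merge {c : ℤ × ℤ → ℤ} (hc : (Set.range c).Finite) {u v : ℤ × ℤ}
    {L : List (ℤ × ℤ)} (h : Annihilates (u :: v :: L) c) (huv : det u v = 0) :
    ∃ w, Annihilates (w :: L) c := by
  have hu : u ≠ 0 := h.1 u (by simp)
  have hv : v ≠ 0 := h.1 v (by simp)
  obtain ⟨p, q, hp, hq, hpq⟩ := exists_parallel_multiple hu hv huv
  refine ⟨p • u, ?_, ?_⟩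
  · intro w hw
    rcases List.mem_cons.1 hw with rfl | hw
    · exact smul_ne_zero hp hu
    · exact h.1 w (by simp [hw])
  · have h1 : diffBy u (diffBy v (diffList L c)) = fun _ => 0 := h.2
    have h2 := diffBy_zsmul_eq_zero h1 p
    rw [diffBy_comm] at h2
    have h3 := diffBy_zsmul_eq_zero h2 q
    rw [← hpq] at h3
    exact periodic_of_diffBy_diffBy (finite_range_diffList hc L) h3

/-- An annihilating list of minimal length. -/
def MinAnnihilates (J : List (ℤ × ℤ)) (c : ℤ × ℤ → ℤ) : Prop :=
  Annihilates J c ∧ ∀ L, Annihilates L c → J.length ≤ L.length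

theorem exists_minAnnihilates {c : ℤ × ℤ → ℤ} (h : ∃ L, Annihilates L c) :
    ∃ J, MinAnnihilates J c := by
  classical
  have h' : ∃ n, ∃ L, Annihilates L c ∧ L.length = n := by
    obtain ⟨L, hL⟩ := h
    exact ⟨_, L, hL, rfl⟩
  obtain ⟨J, hJ, hlen⟩ := Nat.find_spec h'
  exact ⟨J, hJ, fun L hL => by rw [hlen]; exact Nat.find_min' h' ⟨L, hL, rfl⟩⟩

theorem MinAnnihilates.perm {J J' : List (ℤ × ℤ)} {c : ℤ × ℤ → ℤ} (h : MinAnnihilates J c)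
    (hp : J.Perm J') : MinAnnihilates J' c :=
  ⟨h.1.perm hp, fun L hL => by rw [← hp.length_eq]; exact h.2 L hL⟩

theorem MinAnnihilates.det_ne_zero {c : ℤ × ℤ → ℤ} (hc : (Set.range c).Finite) {u v : ℤ × ℤ}
    {L : List (ℤ × ℤ)} (h : MinAnnihilates (u :: v :: L) c) : det u v ≠ 0 := by
  intro huv
  obtain ⟨w, hw⟩ := h.1.merge hc huv
  have := h.2 _ hw
  simp at this

/-- Otherwise `u` could be exchanged for `M • v`, which merges with `v` into a shorter list. This is
the form in which minimality is contradicted throughout. -/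
theorem MinAnnihilates.not_periodic {c : ℤ × ℤ → ℤ} (hc : (Set.range c).Finite) {u v : ℤ × ℤ}
    {L : List (ℤ × ℤ)} (h : MinAnnihilates (u :: v :: L) c) {M : ℤ} (hM : M ≠ 0) :
    diffBy (M • v) (diffList (v :: L) c) ≠ fun _ => 0 := by
  intro h0
  have hv : v ≠ 0 := h.1.1 v (by simp)
  have hann : Annihilates ((M • v) :: v :: L) c := by
    refine ⟨?_, h0⟩
    intro w hw
    rcases List.mem_cons.1 hw with rfl | hw
    · exact smul_ne_zero hM hv
    · exact h.1.1 w (List.mem_cons_of_mem _ hw)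
  obtain ⟨w, hw⟩ := hann.merge hc (by rw [det_smul_left, det_self, mul_zero])
  have := h.2 _ hw
  simp at this

/-- Changing the sign of a vector of an annihilating list. -/
theorem MinAnnihilates.neg_cons {c : ℤ × ℤ → ℤ} {u : ℤ × ℤ} {L : List (ℤ × ℤ)}
    (h : MinAnnihilates (u :: L) c) : MinAnnihilates ((-u) :: L) c := by
  refine ⟨⟨?_, ?_⟩, fun L' hL' => by simpa using h.2 L' hL'⟩
  · intro w hw
    rcases List.mem_cons.1 hw with rfl | hw
    · exact neg_ne_zero.2 (h.1.1 u (by simp))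
    · exact h.1.1 w (List.mem_cons_of_mem _ hw)
  · have := diffBy_zsmul_eq_zero (h.1.2 : diffBy u (diffList L c) = fun _ => 0) (-1)
    rwa [neg_one_smul] at this

/-! ### Faces of the support of a relation -/

theorem eq_combination {z u : ℤ × ℤ} (hz : det z u = 1) (x : ℤ × ℤ) :
    x = det x u • z + det z x • u := by
  obtain ⟨a, b⟩ := z
  obtain ⟨p, q⟩ := u
  obtain ⟨s, t⟩ := x
  simp only [det] at *
  simp only [Prod.smul_mk, smul_eq_mul, Prod.mk_add_mk, Prod.mk.injEq]
  constructor
  · linear_combination (-s) * hz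
  · linear_combination (-t) * hz

/-- A finite-valued function with a period along `u` that satisfies a linear relation whose support
has a one-point face in the direction of `u` is periodic along a complementary vector `z`. -/
theorem periodic_of_vertex {d : ℤ × ℤ → ℤ} (hd : (Set.range d).Finite) {z u : ℤ × ℤ}
    (hz : det z u = 1) {m : ℕ} (hm : 0 < m) (hper : ∀ x, d (x + (m : ℤ) • u) = d x)
    {B : Finset (ℤ × ℤ)} {F : ℤ × ℤ → ℤ} (hrel : ∀ x, ∑ v ∈ B, F v * d (x + v) = 0)
    {v₀ : ℤ × ℤ} (hv₀ : v₀ ∈ B) (hF : F v₀ ≠ 0)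
    (hface : ∀ v ∈ B, F v ≠ 0 → v ≠ v₀ → det v₀ u < det v u) :
    ∃ Q : ℕ, 0 < Q ∧ ∀ x, d (x + (Q : ℤ) • z) = d x := by
  classical
  obtain ⟨W, hW⟩ : ∃ W : ℕ, ∀ v ∈ B, det v u - det v₀ u ≤ W + 1 := by
    refine ⟨(B.sup fun v => (det v u - det v₀ u).toNat), fun v hv => ?_⟩
    have := Finset.le_sup (f := fun v => (det v u - det v₀ u).toNat) hv
    omega
  have := hd.to_subtype
  -- The state is a slab of `W + 1` columns parallel to `u`, read modulo the period. The one-point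
  -- face lets the relation compute the next column from the slab.
  let s : ℤ → (Fin (W + 1) × Fin m → Set.range d) :=
    fun k p => ⟨d (((p.1 : ℤ) + 1 - k) • z + ((p.2 : ℕ) : ℤ) • u), _, rfl⟩
  have hs : ∀ k l, s k = s l → ∀ a : ℤ, 1 ≤ a → a ≤ W + 1 → ∀ b : ℤ,
      d ((a - k) • z + b • u) = d ((a - l) • z + b • u) := by
    intro k l hkl a ha1 ha2 b
    have hm' : (0 : ℤ) < m := by exact_mod_cast hm
    have hb1 := Int.emod_nonneg b hm'.ne'
    have hb2 := Int.emod_lt_of_pos b hm'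
    have hred : ∀ y : ℤ × ℤ, d (y + b • u) = d (y + (b % m) • u) := by
      intro y
      rw [← periodic_zsmul hper (b / m) (y + (b % m) • u)]
      congr 1
      rw [smul_smul, add_assoc, ← add_smul, mul_comm, Int.emod_add_mul_ediv]
    have := congrArg Subtype.val (congrFun hkl (⟨(a - 1).toNat, by omega⟩, ⟨(b % m).toNat, by omega⟩))
    simp only [s, Int.toNat_of_nonneg hb1, Int.toNat_of_nonneg (sub_nonneg.2 ha1),
      sub_add_cancel] at this
    rw [hred, hred, this]
  have hzero : ∀ k l, s k = s l → ∀ b : ℤ,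
      d ((0 - k) • z + b • u) = d ((0 - l) • z + b • u) := by
    intro k l hkl b
    have hsum : ∀ k : ℤ, F v₀ * d ((0 - k) • z + b • u) = - ∑ v ∈ B.erase v₀,
        F v * d ((det (v - v₀) u - k) • z + (b + det z (v - v₀)) • u) := by
      intro k
      have h1 := hrel ((0 - k) • z + b • u - v₀)
      rw [← Finset.add_sum_erase _ _ hv₀] at h1
      rw [sub_add_cancel] at h1
      refine eq_neg_of_add_eq_zero_left (Eq.trans ?_ h1)
      congr 1
      refine Finset.sum_congr rfl fun v _ => ?_
      congr 2
      conv_rhs => rw [sub_add_eq_add_sub, add_sub_assoc, eq_combination hz (v - v₀)]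
      module
    have h2 : F v₀ * d ((0 - k) • z + b • u) = F v₀ * d ((0 - l) • z + b • u) := by
      rw [hsum, hsum]
      congr 1
      refine Finset.sum_congr rfl fun v hv => ?_
      by_cases hFv : F v = 0
      · rw [hFv, zero_mul, zero_mul]
      · have h3 := hface v (Finset.mem_of_mem_erase hv) hFv (Finset.ne_of_mem_erase hv)
        have h4 := hW v (Finset.mem_of_mem_erase hv)
        rw [hs k l hkl _ (by rw [det_sub_left]; omega) (by rw [det_sub_left]; omega)]
    exact mul_left_cancel₀ hF h2
  obtain ⟨Q, hQ, hQper⟩ := int_periodic_of_deterministic s (by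
    intro k l hkl
    funext p
    apply Subtype.ext
    simp only [s]
    rw [show (p.1 : ℤ) + 1 - (k + 1) = p.1 - k by ring,
      show (p.1 : ℤ) + 1 - (l + 1) = p.1 - l by ring]
    rcases Nat.eq_zero_or_pos (p.1 : ℕ) with h0 | h0
    · rw [h0]
      exact hzero k l hkl _
    · exact hs k l hkl _ (by omega) (by have := p.1.2; omega) _)
  refine ⟨Q, hQ, fun x => ?_⟩
  have h1 := hs _ _ (hQper (1 - det x u - Q)) 1 le_rfl (by omega) (det z x)
  rw [show (1 : ℤ) - (1 - det x u - Q + Q) = det x u by ring,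
    show (1 : ℤ) - (1 - det x u - Q) = det x u + Q by ring] at h1
  rw [← eq_combination hz x] at h1
  rw [h1]
  congr 1
  conv_lhs => rw [eq_combination hz x]
  module

theorem sum_mul_diffList (B : Finset (ℤ × ℤ)) (F c : ℤ × ℤ → ℤ) (L : List (ℤ × ℤ)) :
    diffList L (fun x => ∑ v ∈ B, F v * c (x + v)) =
      fun x => ∑ v ∈ B, F v * diffList L c (x + v) := by
  induction L with
  | nil => rfl
  | cons u L ih =>
    rw [diffList_cons, ih]
    funext x
    simp only [diffBy, diffList_cons, ← Finset.sum_sub_distrib, mul_sub]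
    refine Finset.sum_congr rfl fun v _ => ?_
    rw [add_right_comm x u v]

theorem relation_diffBy {B : Finset (ℤ × ℤ)} {F c : ℤ × ℤ → ℤ} {K : ℤ}
    (h : ∀ x, ∑ v ∈ B, F v * c (x + v) = K) (v : ℤ × ℤ) (L : List (ℤ × ℤ)) (x : ℤ × ℤ) :
    ∑ w ∈ B, F w * diffList (v :: L) c (x + w) = 0 := by
  have h1 := congrFun (sum_mul_diffList B F c (v :: L)) x
  rw [← h1, funext h, diffList_cons, ← diffList_diffBy]
  have : (diffBy v fun _ => K) = fun _ => 0 := by funext x; simp [diffBy]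
  rw [this, diffList_zero]

/-- Every nontrivial linear relation for `c` has at least two points on the face in the direction of
a vector of a minimal annihilating list. -/
theorem MinAnnihilates.exists_face {c : ℤ × ℤ → ℤ} (hc : (Set.range c).Finite) {z u v : ℤ × ℤ}
    {m : ℤ} {L : List (ℤ × ℤ)} (h : MinAnnihilates (m • u :: v :: L) c) (hz : det z u = 1)
    {B : Finset (ℤ × ℤ)} {F : ℤ × ℤ → ℤ} {K : ℤ}
    (hrel : ∀ x, ∑ v ∈ B, F v * c (x + v) = K) (hF : ∃ v ∈ B, F v ≠ 0) :
    ∃ p ∈ B, ∃ q ∈ B, p ≠ q ∧ F p ≠ 0 ∧ F q ≠ 0 ∧ det p u = det q u ∧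
      ∀ w ∈ B, F w ≠ 0 → det p u ≤ det w u := by
  classical
  obtain ⟨v₀, hv₀, hF₀⟩ := hF
  obtain ⟨p, hp, hmin⟩ := Finset.exists_min_image (B.filter fun v => F v ≠ 0) (fun v => det v u)
    ⟨v₀, Finset.mem_filter.2 ⟨hv₀, hF₀⟩⟩
  rw [Finset.mem_filter] at hp
  have hmin' : ∀ w ∈ B, F w ≠ 0 → det p u ≤ det w u := fun w hw hFw =>
    hmin w (Finset.mem_filter.2 ⟨hw, hFw⟩)
  by_contra! hcon
  have hm : m ≠ 0 := by
    rintro rfl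
    exact h.1.1 (0 • u) (by simp) (zero_smul _ _)
  set d := diffList (v :: L) c with hd
  have hper : diffBy (m • u) d = fun _ => 0 := h.1.2
  have hper' : diffBy ((m.natAbs : ℤ) • u) d = fun _ => 0 := by
    obtain hm' | hm' := Int.natAbs_eq m
    · rwa [← hm']
    · have := diffBy_zsmul_eq_zero hper (-1)
      rw [smul_smul] at this
      rwa [show (m.natAbs : ℤ) = -1 * m by omega]
  obtain ⟨Q, hQ, hQper⟩ := periodic_of_vertex (finite_range_diffList hc (v :: L)) hz
    (Int.natAbs_pos.2 hm) (diffBy_eq_zero_iff.1 hper') (relation_diffBy hrel v L) hp.1 hp.2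
    (fun w hw hFw hwp => by
      refine lt_of_le_of_ne (hmin' w hw hFw) fun heq => ?_
      obtain ⟨w', hw', hFw', hlt⟩ := hcon p hp.1 w hw hwp.symm hp.2 hFw heq
      exact absurd (hmin' w' hw' hFw') (not_le.2 hlt))
  -- With a one-point face `d` has the periods `Q • z` and `m • u`, and `(m * Q) • v` is an integer
  -- combination of them.
  refine h.not_periodic hc (M := m * Q) (mul_ne_zero hm (by exact_mod_cast hQ.ne')) ?_
  rw [diffBy_eq_zero_iff]
  intro x
  rw [← hd] at hQper ⊢
  have h1 := periodic_zsmul hQper (m * det v u)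
  have h2 := periodic_zsmul (diffBy_eq_zero_iff.1 hper) (Q * det z v)
  rw [← h1 x, ← h2 (x + (m * det v u) • (Q : ℤ) • z)]
  congr 1
  conv_lhs => rw [eq_combination hz v]
  module

/-! ### Lines in rectangles of height three -/

theorem mem_rectangle {n k : ℕ} {x : ℤ × ℤ} :
    x ∈ rectangle n k ↔ (0 ≤ x.1 ∧ x.1 < n) ∧ (0 ≤ x.2 ∧ x.2 < k) := by
  simp [rectangle, Finset.mem_product]

theorem card_rectangle (n k : ℕ) : (rectangle n k).card = n * k := by
  simp [rectangle, Finset.card_product]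

theorem rectangle_convex {n k : ℕ} {p u : ℤ × ℤ} {s t : ℤ} (h0 : p ∈ rectangle n k)
    (h1 : p + t • u ∈ rectangle n k) (hs : 0 ≤ s) (hst : s ≤ t) : p + s • u ∈ rectangle n k := by
  obtain ⟨x, y⟩ := p
  obtain ⟨a, b⟩ := u
  simp only [mem_rectangle, Prod.smul_mk, smul_eq_mul, Prod.mk_add_mk] at *
  have key : ∀ (x a N : ℤ), 0 ≤ x → x < N → 0 ≤ x + t * a → x + t * a < N →
      0 ≤ x + s * a ∧ x + s * a < N := by
    intro x a N h1 h2 h3 h4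
    rcases le_total 0 a with ha | ha
    · have e1 := mul_nonneg hs ha
      have e2 := mul_le_mul_of_nonneg_right hst ha
      constructor <;> linarith
    · have e1 := mul_nonpos_of_nonneg_of_nonpos hs ha
      have e2 := mul_le_mul_of_nonpos_right hst ha
      constructor <;> linarith
  exact ⟨key _ _ _ h0.1.1 h0.1.2 h1.1.1 h1.1.2, key _ _ _ h0.2.1 h0.2.2 h1.2.1 h1.2.2⟩

theorem exists_line_base {n h : ℕ} {z u : ℤ × ℤ} (hz : det z u = 1) {k : ℤ}
    (hne : ((rectangle n h).filter fun x => det x u = k).Nonempty) :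
    ∃ b, det b u = k ∧ ∀ t : ℤ, b + t • u ∈ rectangle n h ↔
      0 ≤ t ∧ t < (((rectangle n h).filter fun x => det x u = k).card : ℤ) := by
  classical
  set E := (rectangle n h).filter fun x => det x u = k with hE
  have hmemE : ∀ x, x ∈ E ↔ x ∈ rectangle n h ∧ det x u = k := fun x => Finset.mem_filter
  obtain ⟨p, hp, hmin⟩ := E.exists_min_image (det z) hne
  obtain ⟨q, hq, hmax⟩ := E.exists_max_image (det z) hne
  have hform : ∀ x, det x u = k → x = p + (det z x - det z p) • u := by
    intro x hx
    conv_lhs => rw [eq_combination hz x, hx, ← ((hmemE p).1 hp).2]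
    conv_rhs => enter [1]; rw [eq_combination hz p]
    module
  have hdet : ∀ t : ℤ, det (p + t • u) u = k ∧ det z (p + t • u) = det z p + t := by
    intro t
    rw [det_add_left, det_smul_left, det_self, det_add_right, det_smul_right, hz,
      ((hmemE p).1 hp).2]
    constructor <;> ring
  have hiff : ∀ t : ℤ, p + t • u ∈ rectangle n h ↔ 0 ≤ t ∧ t ≤ det z q - det z p := by
    intro t
    constructor
    · intro ht
      have hmem := (hmemE _).2 ⟨ht, (hdet t).1⟩
      have h1 := hmin _ hmem
      have h2 := hmax _ hmem
      rw [(hdet t).2] at h1 h2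
      constructor <;> linarith
    · rintro ⟨h1, h2⟩
      refine rectangle_convex ((hmemE p).1 hp).1 (t := det z q - det z p) ?_ h1 h2
      rw [← hform q ((hmemE q).1 hq).2]
      exact ((hmemE q).1 hq).1
  have hcard : (E.card : ℤ) = det z q - det z p + 1 := by
    have hb : E = (Finset.Icc 0 (det z q - det z p)).image fun t : ℤ => p + t • u := by
      ext x
      rw [hmemE, Finset.mem_image]
      constructor
      · rintro ⟨hx, hxk⟩
        refine ⟨det z x - det z p, Finset.mem_Icc.2 ?_, (hform x hxk).symm⟩
        rw [← hiff, ← hform x hxk]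
        exact hx
      · rintro ⟨t, ht, rfl⟩
        exact ⟨(hiff t).2 (Finset.mem_Icc.1 ht), (hdet t).1⟩
    rw [hb, Finset.card_image_of_injective, Int.card_Icc]
    · have := hmax p hp
      omega
    · intro s t hst
      have h1 := (hdet s).2
      have h2 := (hdet t).2
      simp only at hst
      rw [hst] at h1
      linarith
  refine ⟨p, ((hmemE p).1 hp).2, fun t => ?_⟩
  rw [hiff, hcard]
  omega

/-- The cases of a direction with two lattice points on some line of a rectangle of height 3. -/
theorem abs_snd_le_two {n : ℕ} {p u : ℤ × ℤ} (h0 : p ∈ rectangle n 3)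
    (h1 : p + u ∈ rectangle n 3) : -2 ≤ u.2 ∧ u.2 ≤ 2 := by
  simp only [mem_rectangle, Prod.snd_add, Prod.fst_add] at h0 h1
  push_cast at h0 h1
  omega

/-- A discrete convexity special to low height: between a line with two points and a line with `m`
points, every parallel lattice line loses at most one point. Horizontal lines are all full;
otherwise `m ≤ 3`, and the points are found row by row. -/
theorem exists_segment_between {n : ℕ} {z u p b : ℤ × ℤ} (hz : det z u = 1) {a m : ℤ}
    (hp : p ∈ rectangle n 3) (hpu : p + u ∈ rectangle n 3) (hm : 2 ≤ m)
    (hb : ∀ t : ℤ, 0 ≤ t → t < m → b + t • u ∈ rectangle n 3)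
    (h1 : det p u ≤ a) (h2 : a ≤ det b u) :
    ∃ b', det b' u = a ∧ ∀ t : ℤ, 0 ≤ t → t < m - 1 → b' + t • u ∈ rectangle n 3 := by
  obtain ⟨hβ1, hβ2⟩ := abs_snd_le_two hp hpu
  have hb0 := hb 0 le_rfl (by omega)
  have hb1 := hb 1 (by omega) (by omega)
  have hbm := hb (m - 1) (by omega) (by omega)
  obtain ⟨α, β⟩ := u
  obtain ⟨p1, p2⟩ := p
  obtain ⟨b1, b2⟩ := b
  obtain ⟨z1, z2⟩ := z
  simp only [mem_rectangle, Prod.smul_mk, smul_eq_mul, Prod.mk_add_mk, det, zero_mul, add_zero,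
    one_mul, Nat.cast_ofNat] at *
  rcases eq_or_ne β 0 with rfl | hβ
  · have hα : α = 1 ∨ α = -1 := by
      apply Int.isUnit_iff.1
      exact IsUnit.of_mul_eq_one (-z2) (by linarith)
    refine ⟨(b1, -α * a), ?_, fun t ht1 ht2 => ?_⟩
    · rcases hα with rfl | rfl <;> ring
    · have := hb t ht1 (by omega)
      rcases hα with rfl | rfl <;> simp only [mul_zero, Prod.mk_add_mk] at * <;> omega
  · have hm3 : m = 2 ∨ (m = 3 ∧ (β = 1 ∨ β = -1)) := by
      have h3 : -2 ≤ (m - 1) * β ∧ (m - 1) * β ≤ 2 := by omega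
      rcases lt_or_gt_of_ne hβ with h | h
      · have h4 : m ≤ 3 := by nlinarith
        interval_cases m <;> omega
      · have h4 : m ≤ 3 := by nlinarith
        interval_cases m <;> omega
    rcases hm3 with rfl | ⟨rfl, hβ3⟩
    · have ht0 : ∀ t : ℤ, 0 ≤ t → t < 2 - 1 → t = 0 := fun t _ _ => by omega
      suffices h : ∃ x y : ℤ, x * β - y * α = a ∧ (0 ≤ x ∧ x < n) ∧ 0 ≤ y ∧ y < 3 by
        obtain ⟨x, y, hxy, hr⟩ := h
        refine ⟨(x, y), hxy, fun t h3 h4 => ?_⟩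
        rw [ht0 t h3 h4]
        simpa using hr
      clear hb hbm ht0
      have hp2 : p2 = 0 ∨ p2 = 1 ∨ p2 = 2 := by omega
      have hb2 : b2 = 0 ∨ b2 = 1 ∨ b2 = 2 := by omega
      have hβ4 : β = -2 ∨ β = -1 ∨ β = 1 ∨ β = 2 := by omega
      -- Primitivity of `u`. If `β = ±2` then `α` is odd, and the parity of `a` decides which row
      -- meets the line in a lattice point.
      have hpar : β = 1 ∨ β = -1 ∨ α % 2 = 1 := by
        rcases Int.emod_two_eq_zero_or_one α with h | h
        · rcases hβ4 with rfl | rfl | rfl | rfl <;> try omega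
          all_goals
            obtain ⟨γ, rfl⟩ : ∃ γ, α = 2 * γ := ⟨α / 2, by omega⟩
            have : 2 * (z1 * (-1) - z2 * γ) = 1 ∨ 2 * (z1 * 1 - z2 * γ) = 1 := by
              first
              | left; linarith
              | right; linarith
            omega
        · exact Or.inr (Or.inr h)
      rcases hpar with rfl | rfl | hodd
      · refine ⟨a + α, 1, by ring, ?_, by omega, by omega⟩
        rcases hp2 with rfl | rfl | rfl <;> rcases hb2 with rfl | rfl | rfl <;> omega
      · refine ⟨-(a + α), 1, by ring, ?_, by omega, by omega⟩
        rcases hp2 with rfl | rfl | rfl <;> rcases hb2 with rfl | rfl | rfl <;> omega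
      · have hβ5 : β = -2 ∨ β = -1 ∨ β = 1 ∨ β = 2 := hβ4
        rcases hβ5 with rfl | rfl | rfl | rfl
        · rcases Int.emod_two_eq_zero_or_one a with h | h
          · refine ⟨-(a / 2), 0, by omega, ?_, by omega, by omega⟩
            rcases hp2 with rfl | rfl | rfl <;> rcases hb2 with rfl | rfl | rfl <;> omega
          · refine ⟨-((a + α) / 2), 1, by omega, ?_, by omega, by omega⟩
            rcases hp2 with rfl | rfl | rfl <;> rcases hb2 with rfl | rfl | rfl <;> omega
        · refine ⟨-(a + α), 1, by ring, ?_, by omega, by omega⟩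
          rcases hp2 with rfl | rfl | rfl <;> rcases hb2 with rfl | rfl | rfl <;> omega
        · refine ⟨a + α, 1, by ring, ?_, by omega, by omega⟩
          rcases hp2 with rfl | rfl | rfl <;> rcases hb2 with rfl | rfl | rfl <;> omega
        · rcases Int.emod_two_eq_zero_or_one a with h | h
          · refine ⟨a / 2, 0, by omega, ?_, by omega, by omega⟩
            rcases hp2 with rfl | rfl | rfl <;> rcases hb2 with rfl | rfl | rfl <;> omega
          · refine ⟨(a + α) / 2, 1, by omega, ?_, by omega, by omega⟩
            rcases hp2 with rfl | rfl | rfl <;> rcases hb2 with rfl | rfl | rfl <;> omega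
    · have ht01 : ∀ t : ℤ, 0 ≤ t → t < 3 - 1 → t = 0 ∨ t = 1 := fun t _ _ => by omega
      suffices h : ∃ x y : ℤ, x * β - y * α = a ∧ ((0 ≤ x ∧ x < n) ∧ 0 ≤ y ∧ y < 3) ∧
          ((0 ≤ x + α ∧ x + α < n) ∧ 0 ≤ y + β ∧ y + β < 3) by
        obtain ⟨x, y, hxy, hr1, hr2⟩ := h
        refine ⟨(x, y), hxy, fun t h3 h4 => ?_⟩
        rcases ht01 t h3 h4 with rfl | rfl
        · simpa using hr1
        · simpa using hr2
      clear hb ht01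
      have hp2 : p2 = 0 ∨ p2 = 1 ∨ p2 = 2 := by omega
      rcases hβ3 with rfl | rfl
      · have hb2 : b2 = 0 := by omega
        subst hb2
        rcases hp2 with rfl | rfl | rfl
        · exact ⟨a, 0, by ring, by omega, by omega⟩
        · exact ⟨a + α, 1, by ring, by omega, by omega⟩
        · omega
      · have hb2 : b2 = 2 := by omega
        subst hb2
        rcases hp2 with rfl | rfl | rfl
        · omega
        · exact ⟨-(a + α), 1, by ring, by omega, by omega⟩
        · exact ⟨-(a + 2 * α), 2, by ring, by omega, by omega⟩

/-- This bounds the order of a recurrence along any parallel line by the number of points on the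
given one. For a nonhorizontal `u`, three rows force `s ≤ 2`; for a horizontal one, `m` is the full
width. -/
theorem line_spread_le {n : ℕ} {z u b v : ℤ × ℤ} (hz : det z u = 1) {m s : ℤ} (hm : 2 ≤ m)
    (hb : ∀ t : ℤ, b + t • u ∈ rectangle n 3 ↔ 0 ≤ t ∧ t < m)
    (hv : v ∈ rectangle n 3) (hv' : v + s • u ∈ rectangle n 3) : s ≤ m := by
  have hb0 := (hb 0).2 ⟨le_rfl, by omega⟩
  obtain ⟨α, β⟩ := u
  obtain ⟨v1, v2⟩ := v
  obtain ⟨b1, b2⟩ := b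
  obtain ⟨z1, z2⟩ := z
  simp only [mem_rectangle, Prod.smul_mk, smul_eq_mul, Prod.mk_add_mk, det, zero_mul, add_zero,
    Nat.cast_ofNat] at *
  rcases lt_trichotomy β 0 with h | rfl | h
  · by_contra! hs
    nlinarith
  · have hα : α = 1 ∨ α = -1 := by
      apply Int.isUnit_iff.1
      exact IsUnit.of_mul_eq_one (-z2) (by linarith)
    simp only [mul_zero, add_zero] at *
    rcases hα with rfl | rfl
    · have h3 := (hb (-b1)).1 (by omega)
      have h4 := (hb (n - 1)).1 (by omega)
      omega
    · have h3 := (hb (-(n - 1 - b1))).1 (by omega)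
      have h4 := (hb (n - 1)).1 (by omega)
      omega
  · by_contra! hs
    nlinarith

/-! ### Words with several extensions -/

/-- The `B'`-words with at least two extensions to `B`-words. -/
def ambiguous (c : ℤ × ℤ → ℤ) {B' B : Finset (ℤ × ℤ)} (h : B' ⊆ B) : Set (B' → ℤ) :=
  {p | ∃ w₁ ∈ words c B, ∃ w₂ ∈ words c B, w₁ ≠ w₂ ∧
    (fun x : B' => w₁ ⟨x, h x.2⟩) = p ∧ (fun x : B' => w₂ ⟨x, h x.2⟩) = p}

theorem ambiguous_subset_words (c : ℤ × ℤ → ℤ) {B' B : Finset (ℤ × ℤ)} (h : B' ⊆ B) :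
    ambiguous c h ⊆ words c B' := by
  rintro p ⟨_, ⟨u, rfl⟩, _, _, _, rfl, _⟩
  exact ⟨u, rfl⟩

/-- Choose one extension `σ` of every word and a second one `τ` of every ambiguous word; the two
families are disjoint. -/
theorem ncard_ambiguous_add_le {c : ℤ × ℤ → ℤ} (hc : (Set.range c).Finite)
    {B' B : Finset (ℤ × ℤ)} (h : B' ⊆ B) :
    (ambiguous c h).ncard + complexity c B' ≤ complexity c B := by
  classical
  let ρ : (B → ℤ) → (B' → ℤ) := fun w x => w ⟨x, h x.2⟩
  have hσ : ∀ p : B' → ℤ, ∃ w, p ∈ words c B' → w ∈ words c B ∧ ρ w = p := by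
    intro p
    by_cases hp : p ∈ words c B'
    · obtain ⟨u, rfl⟩ := hp
      exact ⟨fun x => translate u c x, fun _ => ⟨⟨u, rfl⟩, rfl⟩⟩
    · exact ⟨fun _ => 0, fun hp' => absurd hp' hp⟩
  choose σ hσ using hσ
  have hτ : ∀ p : B' → ℤ, ∃ w, p ∈ ambiguous c h → w ∈ words c B ∧ ρ w = p ∧ w ≠ σ p := by
    intro p
    by_cases hp : p ∈ ambiguous c h
    · obtain ⟨w₁, h₁, w₂, h₂, hne, hr₁, hr₂⟩ := id hp
      by_cases hw : w₁ = σ p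
      · exact ⟨w₂, fun _ => ⟨h₂, hr₂, fun h' => hne (hw.trans h'.symm)⟩⟩
      · exact ⟨w₁, fun _ => ⟨h₁, hr₁, hw⟩⟩
    · exact ⟨fun _ => 0, fun hp' => absurd hp' hp⟩
  choose τ hτ using hτ
  have hamb := ambiguous_subset_words c h
  have hfin' := words_finite hc B'
  have hfin := words_finite hc B
  have h1 : (τ '' ambiguous c h).ncard = (ambiguous c h).ncard := by
    apply Set.InjOn.ncard_image
    intro p hp q hq hpq
    rw [← (hτ p hp).2.1, ← (hτ q hq).2.1, hpq]
  have h2 : (σ '' words c B').ncard = complexity c B' := by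
    apply Set.InjOn.ncard_image
    intro p hp q hq hpq
    rw [← (hσ p hp).2, ← (hσ q hq).2, hpq]
  have hdisj : Disjoint (τ '' ambiguous c h) (σ '' words c B') := by
    rw [Set.disjoint_left]
    rintro _ ⟨p, hp, rfl⟩ ⟨q, hq, hpq⟩
    have : q = p := by rw [← (hσ q hq).2, hpq, (hτ p hp).2.1]
    subst this
    exact (hτ q hp).2.2 hpq.symm
  rw [← h1, ← h2, ← Set.ncard_union_eq hdisj ((hfin'.subset hamb).image _) (hfin'.image _)]
  apply Set.ncard_le_ncard _ hfin
  rintro _ (⟨p, hp, rfl⟩ | ⟨p, hp, rfl⟩)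
  · exact (hτ p hp).1
  · exact (hσ p hp).1

theorem pattern_mem_words {c f : ℤ × ℤ → ℤ} (hf : f ∈ limits c) (B : Finset (ℤ × ℤ))
    (y : ℤ × ℤ) : (fun x : B => f (x + y)) ∈ words c B := by
  obtain ⟨v, hv⟩ := mem_limits_translate hf y B
  exact ⟨v, funext fun x => (hv x x.2).symm⟩

theorem relation_of_mem_limits {c f : ℤ × ℤ → ℤ} (hf : f ∈ limits c) {B : Finset (ℤ × ℤ)}
    {F : ℤ × ℤ → ℤ} {K : ℤ} (h : ∀ x, ∑ v ∈ B, F v * c (x + v) = K) (x : ℤ × ℤ) :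
    ∑ v ∈ B, F v * f (x + v) = K := by
  obtain ⟨w, hw⟩ := mem_limits_translate hf x B
  rw [← h w]
  refine Finset.sum_congr rfl fun v hv => ?_
  have h1 : f (v + x) = c (v + w) := hw v hv
  rw [add_comm x v, h1, add_comm]

theorem diffList_of_mem_limits {c f : ℤ × ℤ → ℤ} (hf : f ∈ limits c) {L : List (ℤ × ℤ)}
    (h : diffList L c = fun _ => 0) : diffList L f = fun _ => 0 := by
  funext x
  obtain ⟨B, hB⟩ := diffList_local L x
  obtain ⟨u, hu⟩ := hf B
  rw [hB f (fun y => c (y + u)) hu, diffList_translate, h]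

/-- Remove lines parallel to `u` one at a time. The empty set has one word, more than its
cardinality, so the inequality breaks at some line. Adding that line creates fewer new words than it
has points. -/
theorem exists_peel {c : ℤ × ℤ → ℤ} (u : ℤ × ℤ) {R : Finset (ℤ × ℤ)}
    (h : complexity c R ≤ R.card) :
    ∃ k : ℤ, complexity c (R.filter fun x => det x u ≤ k) ≤
        (R.filter fun x => det x u ≤ k).card ∧
      (R.filter fun x => det x u ≤ k - 1).card <
        complexity c (R.filter fun x => det x u ≤ k - 1) := by
  obtain ⟨W, hW⟩ : ∃ W : ℕ, ∀ x ∈ R, |det x u| ≤ W := by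
    refine ⟨R.sup fun x => (det x u).natAbs, fun x hx => ?_⟩
    have := Finset.le_sup (f := fun x => (det x u).natAbs) hx
    rw [Int.abs_eq_natAbs]
    exact_mod_cast this
  obtain ⟨k, hk, hleast⟩ := Int.exists_least_of_bdd
    (P := fun k : ℤ => complexity c (R.filter fun x => det x u ≤ k) ≤
        (R.filter fun x => det x u ≤ k).card)
    ⟨-W, fun k hk => by
      by_contra! hlt
      have hempty : (R.filter fun x => det x u ≤ k) = ∅ := by
        rw [Finset.filter_eq_empty_iff]
        intro x hx
        have := abs_le.1 (hW x hx)
        omega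
      rw [hempty, Finset.card_empty, Nat.le_zero] at hk
      have hne : (words c ∅).Nonempty := ⟨_, 0, rfl⟩
      exact absurd hk (Set.ncard_pos (Set.toFinite _) |>.2 hne).ne'⟩
    ⟨W, by
      rw [Finset.filter_true_of_mem]
      · exact h
      · intro x hx
        exact (abs_le.1 (hW x hx)).2⟩
  refine ⟨k, hk, ?_⟩
  by_contra! hcon
  have := hleast _ hcon
  omega

/-! ### Recurrences along a line -/

/-- A window of `D` zeros would propagate upward by the recurrence and, by periodicity, kill the
whole sequence. -/
theorem exists_ne_zero_of_recurrence {B : Finset (ℤ × ℤ)} {F i : ℤ × ℤ → ℤ} {e : ℤ → ℤ}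
    {v₁ : ℤ × ℤ} {D t₀ : ℤ} {m : ℕ} (hv₁ : v₁ ∈ B) (hF : F v₁ ≠ 0)
    (hmax : ∀ v ∈ B, F v ≠ 0 → v ≠ v₁ → i v < i v₁ ∧ i v₁ - i v ≤ D)
    (hrec : ∀ t, t₀ ≤ t → ∑ v ∈ B, F v * e (t + i v) = 0) (hm : 0 < m)
    (hper : ∀ j, 0 ≤ j → e (j + m) = e j) (hne : ∃ j, 0 ≤ j ∧ e j ≠ 0) {j : ℤ}
    (hj : t₀ + i v₁ ≤ j) : ∃ s, 0 ≤ s ∧ s < D ∧ e (j + s) ≠ 0 := by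
  classical
  by_contra! hcon
  have hzero : ∀ N : ℕ, e (j + N) = 0 := by
    intro N
    induction N using Nat.strong_induction_on with
    | _ N ih =>
      by_cases hN : (N : ℤ) < D
      · exact hcon N (by omega) hN
      · have h1 := hrec (j + N - i v₁) (by omega)
        rw [← Finset.add_sum_erase _ _ hv₁, Finset.sum_eq_zero, add_zero] at h1
        · rw [sub_add_cancel] at h1
          exact (mul_eq_zero.1 h1).resolve_left hF
        · intro v hv
          by_cases hFv : F v = 0
          · rw [hFv, zero_mul]
          · obtain ⟨h2, h3⟩ := hmax v (Finset.mem_of_mem_erase hv) hFv (Finset.ne_of_mem_erase hv)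
            have h4 := ih (N - (i v₁ - i v).toNat) (by omega)
            rw [show j + ((N - (i v₁ - i v).toNat : ℕ) : ℤ) = j + N - i v₁ + i v by omega] at h4
            rw [h4, mul_zero]
  obtain ⟨j₀, hj₀, hne⟩ := hne
  have hmul : ∀ k : ℕ, e (j₀ + m * k) = e j₀ := by
    intro k
    induction k with
    | zero => simp
    | succ k ih =>
      push_cast
      rw [mul_add, mul_one, ← add_assoc, hper _ (by positivity), ih]
  have h1 := hmul (j - j₀).toNat
  have h2 : (0 : ℤ) ≤ j₀ + m * (j - j₀).toNat - j := by
    have : ((j - j₀).toNat : ℤ) ≤ m * (j - j₀).toNat := by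
      have hm' : (1 : ℤ) ≤ m := by exact_mod_cast hm
      nlinarith [Int.natCast_nonneg (j - j₀).toNat]
    omega
  have h3 := hzero (j₀ + m * (j - j₀).toNat - j).toNat
  rw [Int.toNat_of_nonneg h2, add_sub_cancel] at h3
  exact hne (h1 ▸ h3)

theorem eventually_periodic_mul {φ : ℤ → ℤ} {κ : ℤ} {M : ℕ}
    (h : ∀ i, κ ≤ i → φ (i + M) = φ i) (k : ℕ) :
    ∀ i, κ ≤ i → φ (i + (M * k : ℕ)) = φ i := by
  induction k with
  | zero => intro i _; simp
  | succ k ih =>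
    intro i hi
    rw [Nat.mul_succ]
    push_cast
    rw [← add_assoc, h _ (by have : (0 : ℤ) ≤ M * k := by positivity
                             linarith)]
    exact_mod_cast ih i hi

/-- The point with coordinates `(a, i)` in the basis `z, u`. -/
def pt (z u : ℤ × ℤ) (a i : ℤ) : ℤ × ℤ := a • z + i • u

theorem pt_add {z u : ℤ × ℤ} (hz : det z u = 1) (a i : ℤ) (v : ℤ × ℤ) :
    pt z u a i + v = pt z u (a + det v u) (i + det z v) := by
  unfold pt
  conv_lhs => rw [eq_combination hz v]
  module

theorem eq_pt {z u : ℤ × ℤ} (hz : det z u = 1) (x : ℤ × ℤ) : x = pt z u (det x u) (det z x) :=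
  eq_combination hz x

theorem exists_det_bound (R : Finset (ℤ × ℤ)) (z u : ℤ × ℤ) :
    ∃ W : ℕ, ∀ x ∈ R, |det x u| ≤ W ∧ |det z x| ≤ W := by
  refine ⟨R.sup fun x => (det x u).natAbs + (det z x).natAbs, fun x hx => ?_⟩
  have := Finset.le_sup (f := fun x => (det x u).natAbs + (det z x).natAbs) hx
  rw [Int.abs_eq_natAbs, Int.abs_eq_natAbs]
  have h : (det x u).natAbs + (det z x).natAbs ≤
    R.sup fun x => (det x u).natAbs + (det z x).natAbs := this
  omega

/-- A relation propagates eventual periodicity along columns to the next column. -/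
theorem column_periodic {S : Set ℤ} (hS : S.Finite) {z u : ℤ × ℤ} (hz : det z u = 1)
    {B : Finset (ℤ × ℤ)} {F : ℤ × ℤ → ℤ} {K : ℤ} {v₀ : ℤ × ℤ} (hv₀ : v₀ ∈ B) (hF : F v₀ ≠ 0)
    {N : ℤ} (hleft : ∀ v ∈ B, F v ≠ 0 → det v₀ u ≤ det v u ∧ det v u ≤ det v₀ u + N)
    (htop : ∀ v ∈ B, F v ≠ 0 → v ≠ v₀ → det v u = det v₀ u → det z v < det z v₀)
    {M : ℕ} (hM : 0 < M) (κ : ℕ) :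
    ∃ M' : ℕ, 0 < M' ∧ M ∣ M' ∧ ∃ κ' : ℕ, κ ≤ κ' ∧ ∀ f : ℤ × ℤ → ℤ, (∀ x, f x ∈ S) →
      (∀ x, ∑ v ∈ B, F v * f (x + v) = K) → ∀ A : ℤ,
      (∀ a, A < a → a ≤ A + N → ∀ i : ℤ, κ ≤ i → f (pt z u a (i + M)) = f (pt z u a i)) →
      ∀ i : ℤ, κ' ≤ i → f (pt z u A (i + M')) = f (pt z u A i) := by
  classical
  obtain ⟨W, hW⟩ := exists_det_bound B z u
  have := hS.to_subtype
  set D : ℕ := 2 * W + 1 with hD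
  set C : ℕ := Nat.card (Fin M × (Fin D → S)) with hC
  refine ⟨M * C.factorial, Nat.mul_pos hM (Nat.factorial_pos _), dvd_mul_right _ _,
    κ + D + C, by omega, fun f hfS hrel A hA => ?_⟩
  have hmod : ∀ a, A < a → a ≤ A + N → ∀ p : ℤ, κ ≤ p → ∀ j j' : ℕ, j % M = j' % M →
      f (pt z u a (p + j)) = f (pt z u a (p + j')) := by
    intro a ha1 ha2 p hp j j' hjj
    have hred : ∀ j : ℕ, f (pt z u a (p + j)) = f (pt z u a (p + (j % M : ℕ))) := by
      intro j
      have h1 := eventually_periodic_mul (φ := fun i => f (pt z u a i)) (hA a ha1 ha2) (j / M)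
        (p + (j % M : ℕ)) (by omega)
      rw [← h1]
      congr 2
      have := Nat.mod_add_div j M
      rw [add_assoc]
      congr 1
      exact_mod_cast this.symm
    rw [hred, hred j', hjj]
  -- The state records the phase of the columns to the right and a window of column `A` longer than
  -- the vertical spread `2 * W` of the relation. Since `v₀` is the top point of the leftmost
  -- column, the relation computes the next value.
  let s : ℕ → Fin M × (Fin D → S) := fun j =>
    (⟨j % M, Nat.mod_lt _ hM⟩, fun d => ⟨f (pt z u A (κ + D + j + (d : ℕ))), hfS _⟩)
  have hval : ∀ j j', s j = s j' → ∀ d : ℕ, d < D →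
      f (pt z u A (κ + D + j + d)) = f (pt z u A (κ + D + j' + d)) := by
    intro j j' hjj d hd
    exact congrArg Subtype.val (congrFun (congrArg Prod.snd hjj) ⟨d, hd⟩)
  have hnext : ∀ j j', s j = s j' →
      f (pt z u A (κ + D + j + D)) = f (pt z u A (κ + D + j' + D)) := by
    intro j j' hjj
    have hjm : j % M = j' % M := congrArg (fun p => (p.1 : ℕ)) hjj
    have hsum : ∀ j : ℕ, F v₀ * f (pt z u A (κ + D + j + D)) = K - ∑ v ∈ B.erase v₀,
        F v * f (pt z u (A + (det v u - det v₀ u)) (κ + D + j + D + (det z v - det z v₀))) := by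
      intro j
      have h1 := hrel (pt z u (A - det v₀ u) (κ + D + j + D - det z v₀))
      rw [← Finset.add_sum_erase _ _ hv₀] at h1
      simp only [pt_add hz] at h1
      rw [sub_add_cancel, sub_add_cancel] at h1
      rw [← h1]
      rw [eq_sub_iff_add_eq]
      congr 1
      refine Finset.sum_congr rfl fun v _ => ?_
      congr 3 <;> ring
    have h2 : F v₀ * f (pt z u A (κ + D + j + D)) = F v₀ * f (pt z u A (κ + D + j' + D)) := by
      rw [hsum, hsum]
      congr 1
      refine Finset.sum_congr rfl fun v hv => ?_
      by_cases hFv : F v = 0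
      · rw [hFv, zero_mul, zero_mul]
      have hvB := Finset.mem_of_mem_erase hv
      have h3 := hleft v hvB hFv
      have h4 := abs_le.1 (hW v hvB).2
      have h5 := abs_le.1 (hW v₀ hv₀).2
      congr 1
      rcases eq_or_lt_of_le h3.1 with heq | hlt
      · have h6 := htop v hvB hFv (Finset.ne_of_mem_erase hv) heq.symm
        have h7 := hval j j' hjj (D - (det z v₀ - det z v).toNat) (by omega)
        rw [show A + (det v u - det v₀ u) = A by omega]
        convert h7 using 3 <;> omega
      · have h7 := hmod (A + (det v u - det v₀ u)) (by omega) (by omega)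
          (κ + D + D + (det z v - det z v₀)) (by omega) j j' hjm
        convert h7 using 3 <;> ring
    exact mul_left_cancel₀ hF h2
  have hdet := periodic_of_deterministic s (by
    intro j j' hjj
    have hjm : j % M = j' % M := congrArg (fun p => (p.1 : ℕ)) hjj
    refine Prod.ext (Fin.ext ?_) (funext fun d => Subtype.ext ?_)
    · simp only [s]
      rw [Nat.add_mod, hjm, ← Nat.add_mod]
    · simp only [s]
      push_cast
      rcases Nat.lt_or_ge ((d : ℕ) + 1) D with h | h
      · have h7 := hval j j' hjj (d + 1) h
        push_cast at h7
        convert h7 using 3 <;> ring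
      · have hd : (d : ℤ) + 1 = D := by have := d.2; omega
        have h7 := hnext j j' hjj
        rw [← hd] at h7
        rw [← hd]
        convert h7 using 3 <;> ring) (N := C) le_rfl
  have hper : ∀ i : ℤ, (κ + D + C : ℕ) ≤ i →
      f (pt z u A (i + C.factorial)) = f (pt z u A i) := by
    intro i hi
    push_cast at hi
    have h1 := hval _ _ (hdet (i - κ - D).toNat (by omega)) 0 (by omega)
    push_cast at h1
    rw [Int.toNat_of_nonneg (by omega)] at h1
    convert h1 using 3 <;> ring
  have := eventually_periodic_mul (φ := fun i => f (pt z u A i)) hper M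
  rwa [mul_comm] at this

/-- Iterates `column_periodic` over `t` further columns to the left; the new period is a multiple of
the old one, so a common period survives. -/
theorem columns_periodic {S : Set ℤ} (hS : S.Finite) {z u : ℤ × ℤ} (hz : det z u = 1)
    {B : Finset (ℤ × ℤ)} {F : ℤ × ℤ → ℤ} {K : ℤ} {v₀ : ℤ × ℤ} (hv₀ : v₀ ∈ B) (hF : F v₀ ≠ 0)
    {N : ℤ} (hleft : ∀ v ∈ B, F v ≠ 0 → det v₀ u ≤ det v u ∧ det v u ≤ det v₀ u + N)
    (htop : ∀ v ∈ B, F v ≠ 0 → v ≠ v₀ → det v u = det v₀ u → det z v < det z v₀)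
    {M : ℕ} (hM : 0 < M) (κ : ℕ) (t : ℕ) :
    ∃ M' : ℕ, 0 < M' ∧ ∃ κ' : ℕ, ∀ f : ℤ × ℤ → ℤ, (∀ x, f x ∈ S) →
      (∀ x, ∑ v ∈ B, F v * f (x + v) = K) → ∀ A : ℤ,
      (∀ a, A < a → a ≤ A + N → ∀ i : ℤ, κ ≤ i → f (pt z u a (i + M)) = f (pt z u a i)) →
      ∀ a, A - t < a → a ≤ A + N → ∀ i : ℤ, κ' ≤ i →
        f (pt z u a (i + M')) = f (pt z u a i) := by
  induction t with
  | zero =>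
    exact ⟨M, hM, κ, fun f _ _ A hA a ha1 ha2 => hA a (by simpa using ha1) ha2⟩
  | succ t ih =>
    obtain ⟨M₁, hM₁, κ₁, h₁⟩ := ih
    obtain ⟨M₂, hM₂, ⟨q, rfl⟩, κ₂, hκ, h₂⟩ :=
      column_periodic (K := K) hS hz hv₀ hF hleft htop hM₁ κ₁
    refine ⟨M₁ * q, hM₂, κ₂, fun f hfS hrel A hA a ha1 ha2 i hi => ?_⟩
    push_cast at ha1
    have h3 := h₁ f hfS hrel A hA
    rcases eq_or_lt_of_le (show A - t ≤ a by omega) with heq | hlt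
    · subst heq
      exact h₂ f hfS hrel (A - t) (fun a ha1 ha2 => h3 a (by omega) (by omega)) i hi
    · exact eventually_periodic_mul (φ := fun i => f (pt z u a i)) (h3 a hlt ha2) q i (by omega)

/-! ### Rays of ambiguous words -/

/-- Every nontrivial linear relation for `c` has two points on the face in the direction of `u`. -/
def HasFaces (c : ℤ × ℤ → ℤ) (u : ℤ × ℤ) : Prop :=
  ∀ (B : Finset (ℤ × ℤ)) (F : ℤ × ℤ → ℤ) (K : ℤ), (∀ x, ∑ v ∈ B, F v * c (x + v) = K) →
    (∃ v ∈ B, F v ≠ 0) → ∃ p ∈ B, ∃ q ∈ B, p ≠ q ∧ F p ≠ 0 ∧ F q ≠ 0 ∧ det p u = det q u ∧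
      ∀ w ∈ B, F w ≠ 0 → det p u ≤ det w u

theorem exists_adjacent {n : ℕ} {z u p q : ℤ × ℤ} (hz : det z u = 1) (hp : p ∈ rectangle n 3)
    (hq : q ∈ rectangle n 3) (hpq : p ≠ q) (h : det p u = det q u) :
    ∃ r ∈ rectangle n 3, r + u ∈ rectangle n 3 ∧ det r u = det p u := by
  wlog hlt : det z p ≤ det z q generalizing p q
  · obtain ⟨r, hr, hru, hr'⟩ := this hq hp hpq.symm h.symm (by omega)
    exact ⟨r, hr, hru, hr'.trans h.symm⟩
  have hq' : q = p + (det z q - det z p) • u := by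
    conv_lhs => rw [eq_combination hz q, ← h]
    conv_rhs => enter [1]; rw [eq_combination hz p]
    module
  have hne : det z p ≠ det z q := by
    intro heq
    rw [heq, sub_self, zero_smul, add_zero] at hq'
    exact hpq hq'.symm
  refine ⟨p, hp, ?_, rfl⟩
  have := rectangle_convex hp (hq' ▸ hq) (s := 1) (by omega) (by omega)
  rwa [one_smul] at this

theorem exists_top {B : Finset (ℤ × ℤ)} {F : ℤ × ℤ → ℤ} {z u p : ℤ × ℤ} (hz : det z u = 1)
    (hp : p ∈ B) (hF : F p ≠ 0) : ∃ v₀ ∈ B, F v₀ ≠ 0 ∧ det v₀ u = det p u ∧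
      ∀ v ∈ B, F v ≠ 0 → v ≠ v₀ → det v u = det v₀ u → det z v < det z v₀ := by
  classical
  obtain ⟨v₀, hv₀, hmax⟩ := (B.filter fun v => F v ≠ 0 ∧ det v u = det p u).exists_max_image
    (det z) ⟨p, Finset.mem_filter.2 ⟨hp, hF, rfl⟩⟩
  obtain ⟨h1, h2, h3⟩ := Finset.mem_filter.1 hv₀
  refine ⟨v₀, h1, h2, h3, fun v hv hFv hne hdet => ?_⟩
  refine lt_of_le_of_ne (hmax v (Finset.mem_filter.2 ⟨hv, hFv, hdet.trans h3⟩)) fun heq => hne ?_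
  rw [eq_pt hz v, eq_pt hz v₀, hdet, heq]

/-- Put the peeled line `E` on column 0 and slide up. The patterns of `f` and `g` agree on `B'` and
differ on `E`, so each `B'`-pattern is ambiguous, and there are at most `|E| - 1` of these.
Morse–Hedlund makes `N` columns periodic, where `N` is the width available to the relation, and the
relation extends this to the left. -/
theorem exists_ray_core {c : ℤ × ℤ → ℤ} (hc : (Set.range c).Finite) {z u : ℤ × ℤ}
    (hz : det z u = 1) {n : ℕ} (hP : complexity c (rectangle n 3) ≤ n * 3)
    (hface : HasFaces c u) {m₀ : ℕ} (hm₀ : 0 < m₀) (w : ℕ) :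
    ∃ M : ℕ, 0 < M ∧ ∃ κ W : ℕ, ∀ f ∈ limits c, ∀ g ∈ limits c,
      (∀ a i : ℤ, -W ≤ a → a < 0 → 0 ≤ i → f (pt z u a i) = g (pt z u a i)) →
      (∀ i : ℤ, 0 ≤ i → f (pt z u 0 (i + m₀)) - g (pt z u 0 (i + m₀)) =
        f (pt z u 0 i) - g (pt z u 0 i)) →
      (∃ i : ℤ, 0 ≤ i ∧ f (pt z u 0 i) ≠ g (pt z u 0 i)) →
      ∀ a i : ℤ, -w ≤ a → a < 0 → κ ≤ i → f (pt z u a (i + M)) = f (pt z u a i) := by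
  classical
  set R := rectangle n 3 with hR
  obtain ⟨W₀, hW₀⟩ := exists_det_bound R z u
  obtain ⟨k, hk1, hk2⟩ := exists_peel u (c := c) (R := R) (by rw [hR, card_rectangle]; exact hP)
  set B := R.filter fun x => det x u ≤ k with hB
  set B' := R.filter fun x => det x u ≤ k - 1 with hB'
  set E := R.filter fun x => det x u = k with hE
  have hmemB : ∀ x, x ∈ B ↔ x ∈ R ∧ det x u ≤ k := fun x => Finset.mem_filter
  have hmemB' : ∀ x, x ∈ B' ↔ x ∈ R ∧ det x u ≤ k - 1 := fun x => Finset.mem_filter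
  have hmemE : ∀ x, x ∈ E ↔ x ∈ R ∧ det x u = k := fun x => Finset.mem_filter
  have hsub : B' ⊆ B := fun x hx => (hmemB x).2
    ⟨((hmemB' x).1 hx).1, by have := ((hmemB' x).1 hx).2; omega⟩
  have hcard : B.card = B'.card + E.card := by
    rw [← Finset.card_union_of_disjoint]
    · congr 1
      ext x
      rw [Finset.mem_union, hmemB, hmemB', hmemE]
      constructor
      · rintro ⟨h1, h2⟩
        rcases eq_or_lt_of_le h2 with h | h
        · exact Or.inr ⟨h1, h⟩
        · exact Or.inl ⟨h1, by omega⟩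
      · rintro (⟨h1, h2⟩ | ⟨h1, h2⟩) <;> exact ⟨h1, by omega⟩
    · rw [Finset.disjoint_left]
      intro x h1 h2
      have := ((hmemB' x).1 h1).2
      have := ((hmemE x).1 h2).2
      omega
  have hamb := ncard_ambiguous_add_le hc hsub
  have hambfin : (ambiguous c hsub).Finite :=
    (words_finite hc B').subset (ambiguous_subset_words c hsub)
  have hm1 : (ambiguous c hsub).ncard + 1 ≤ E.card := by omega
  obtain ⟨b, hbk, hb⟩ := exists_line_base hz (n := n) (h := 3) (k := k)
    (Finset.card_pos.1 (by omega : 0 < E.card))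
  obtain ⟨F, K, hFne, hrel⟩ := exists_relation hc hk1
  obtain ⟨p, hp, q, hq, hpq, hFp, hFq, hdet, hmin⟩ := hface B F K hrel hFne
  obtain ⟨v₀, hv₀, hF₀, hv₀p, htop₀⟩ := exists_top hz hp hFp
  obtain ⟨r, hr, hrmax⟩ := (B.filter fun v => F v ≠ 0).exists_max_image (fun v => det v u)
    ⟨p, Finset.mem_filter.2 ⟨hp, hFp⟩⟩
  rw [Finset.mem_filter] at hr
  obtain ⟨v₁, hv₁, hF₁, hv₁r, htop₁⟩ := exists_top hz hr.1 hr.2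
  obtain ⟨p₀, hp₀, hp₀u, hp₀p⟩ := exists_adjacent hz ((hmemB p).1 hp).1 ((hmemB q).1 hq).1 hpq hdet
  set N := k - det p u with hN
  have hpk := ((hmemB p).1 hp).2
  set s := E.card - 1 with hs
  obtain ⟨M, hM, κ, hper⟩ := columns_periodic (K := K) hc hz hv₀ hF₀ (N := N)
    (fun v hv hFv => ⟨hv₀p ▸ hmin v hv hFv, by have := ((hmemB v).1 hv).2; omega⟩) htop₀
    (Nat.factorial_pos s) (4 * W₀ + s) w
  refine ⟨M, hM, κ, 2 * W₀, fun f hf g hg hagree heper hene a i ha1 ha2 hi => ?_⟩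
  refine hper f (range_subset_of_mem_limits hf) (relation_of_mem_limits hf hrel) (-1 - N) ?_ a
    (by omega) (by omega) i hi
  clear a i ha1 ha2 hi hper
  set e : ℤ → ℤ := fun i => f (pt z u 0 i) - g (pt z u 0 i) with he
  have hxpt : ∀ (x : ℤ × ℤ) (j : ℤ), x + pt z u (-k) j = pt z u (det x u - k) (j + det z x) := by
    intro x j
    rw [add_comm, pt_add hz]
    congr 1
    ring
  have hb2 : ∀ t : ℤ, b + t • u ∈ R ↔ 0 ≤ t ∧ t < (E.card : ℤ) := hb
  have hbR : b ∈ R := by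
    have h1 : (0 : ℤ) < E.card := by omega
    simpa using (hb2 0).2 ⟨le_rfl, h1⟩
  have hbk' := abs_le.1 (hW₀ b hbR).1
  rw [hbk] at hbk'
  have hmemamb : ∀ j : ℤ, W₀ ≤ j → (∃ x ∈ E, e (j + det z x) ≠ 0) →
      (fun x : B' => f (x + pt z u (-k) j)) ∈ ambiguous c hsub := by
    rintro j hj ⟨x, hx, hex⟩
    refine ⟨_, pattern_mem_words hf B _, _, pattern_mem_words hg B (pt z u (-k) j), ?_, rfl, ?_⟩
    · intro heq
      apply hex
      obtain ⟨hxR, hxk⟩ := (hmemE x).1 hx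
      have h1 := congrFun heq ⟨x, (hmemB x).2 ⟨hxR, hxk.le⟩⟩
      simp only [hxpt] at h1
      rw [hxk, sub_self] at h1
      simp only [he, h1, sub_self]
    · funext x
      obtain ⟨hxR, hxk⟩ := (hmemB' x).1 x.2
      have h1 := hW₀ x hxR
      have h2 := abs_le.1 h1.1
      have h3 := abs_le.1 h1.2
      simp only [hxpt]
      exact (hagree _ _ (by push_cast; omega) (by omega) (by omega)).symm
  have hbW := abs_le.1 (hW₀ b hbR).2
  -- With a single peeled point there would be no ambiguous word, yet a difference on column 0,
  -- moved up by its period, produces one.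
  have hm2 : 2 ≤ E.card := by
    by_contra! hlt
    have h0 : (ambiguous c hsub) = ∅ := by
      rw [← Set.ncard_eq_zero hambfin]
      omega
    obtain ⟨i, hi0, hi⟩ := hene
    have h1 := eventually_periodic_mul (φ := e) (κ := 0) heper (2 * W₀) i hi0
    have h2 := hmemamb (i + (m₀ * (2 * W₀) : ℕ) - det z b)
      (by push_cast; nlinarith [Int.natCast_nonneg W₀, (by exact_mod_cast hm₀ : (1 : ℤ) ≤ m₀)])
      ⟨b, (hmemE b).2 ⟨hbR, hbk⟩, by
        rw [sub_add_cancel, h1]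
        exact sub_ne_zero.2 hi⟩
    rw [h0] at h2
    exact h2
  have hall : ∀ j : ℤ, 3 * W₀ ≤ j →
      (fun x : B' => f (x + pt z u (-k) j)) ∈ ambiguous c hsub := by
    intro j hj
    have hv₁R := ((hmemB v₁).1 hv₁).1
    have hv₁W := abs_le.1 (hW₀ v₁ hv₁R).2
    -- When the rightmost support column of the relation sits on column 0, all other columns cancel
    -- in `f - g`. What remains is a recurrence for `e`, and every window of `|E|` points meets a
    -- nonzero value.
    obtain ⟨t, ht1, ht2, hte⟩ := exists_ne_zero_of_recurrence
      (B := B.filter fun v => det v u = det v₁ u) (F := F) (i := det z) (e := e) (D := E.card)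
      (t₀ := W₀) (m := m₀) (v₁ := v₁) (Finset.mem_filter.2 ⟨hv₁, rfl⟩) hF₁
      (by
        intro v hv hFv hne
        obtain ⟨hvB, hvu⟩ := Finset.mem_filter.1 hv
        refine ⟨htop₁ v hvB hFv hne hvu, ?_⟩
        apply line_spread_le hz (by exact_mod_cast hm2) hb ((hmemB v).1 hvB).1
        convert hv₁R using 1
        conv_rhs => rw [eq_combination hz v₁, ← hvu]
        conv_lhs => enter [1]; rw [eq_combination hz v]
        module)
      (by
        intro t ht
        have h1 := relation_of_mem_limits hf hrel (pt z u (-det v₁ u) t)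
        have h2 := relation_of_mem_limits hg hrel (pt z u (-det v₁ u) t)
        have h3 : ∑ v ∈ B, F v * (f (pt z u (-det v₁ u) t + v) - g (pt z u (-det v₁ u) t + v)) = 0 := by
          simp only [mul_sub, Finset.sum_sub_distrib]
          rw [h1, h2, sub_self]
        rw [Finset.sum_filter]
        refine Eq.trans ?_ h3
        refine Finset.sum_congr rfl fun v hv => ?_
        rw [pt_add hz]
        split_ifs with hvu
        · rw [hvu, neg_add_cancel]
        · by_cases hFv : F v = 0
          · rw [hFv, zero_mul]
          · have h4 : det v u ≤ det r u := hrmax v (Finset.mem_filter.2 ⟨hv, hFv⟩)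
            have h5 := hW₀ v ((hmemB v).1 hv).1
            have h6 := abs_le.1 h5.1
            have h7 := abs_le.1 h5.2
            have h8 := abs_le.1 (hW₀ v₁ hv₁R).1
            rw [hagree _ _ (by push_cast; omega) (by omega) (by omega), sub_self, mul_zero])
      hm₀ heper
      (by
        obtain ⟨i, hi0, hi⟩ := hene
        exact ⟨i, hi0, sub_ne_zero.2 hi⟩)
      (j := j + det z b) (by omega)
    refine hmemamb j (by omega) ⟨b + t • u, (hmemE _).2 ⟨(hb t).2 ⟨ht1, ht2⟩, ?_⟩, ?_⟩
    · rw [det_add_left, det_smul_left, det_self, hbk]; ring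
    · rw [det_add_right, det_smul_right, hz, mul_one, ← add_assoc]
      exact hte
  have hseg : ∀ ρ : Fin N.toNat, ∃ b', det b' u = det p u + (ρ : ℕ) ∧
      ∀ t : ℤ, 0 ≤ t → t < (E.card : ℤ) - 1 → b' + t • u ∈ R := by
    intro ρ
    have := ρ.2
    exact exists_segment_between hz hp₀ hp₀u (by exact_mod_cast hm2)
      (fun t h1 h2 => (hb t).2 ⟨h1, h2⟩) (by omega) (by omega)
  choose b' hb'u hb' using hseg
  have hb'W : ∀ ρ, |det z (b' ρ)| ≤ W₀ := fun ρ =>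
    (hW₀ _ (by simpa using hb' ρ 0 le_rfl (by omega))).2
  have hb'mem : ∀ (t : Fin s) ρ, b' ρ + ((t : ℕ) : ℤ) • u ∈ B' := by
    intro t ρ
    have := t.2
    have := ρ.2
    refine (hmemB' _).2 ⟨hb' ρ _ (by omega) (by omega), ?_⟩
    rw [det_add_left, det_smul_left, det_self, mul_zero, add_zero, hb'u]
    omega
  -- One letter of `Y` reads `N` columns at once, each at the offset of its segment in `B'`. These
  -- segments have `s = |E| - 1` points, so a word of length `s` is a function of one ambiguous
  -- pattern.
  let Y : ℕ → (Fin N.toNat → ℤ) := fun j ρ =>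
    f (pt z u (det p u + (ρ : ℕ) - k) (3 * W₀ + j + det z (b' ρ)))
  let Ψ : (B' → ℤ) → (Fin s → Fin N.toNat → ℤ) := fun P t ρ => P ⟨_, hb'mem t ρ⟩
  have hrange : Set.range (wordAt Y s) ⊆ Ψ '' ambiguous c hsub := by
    rintro _ ⟨j, rfl⟩
    refine ⟨_, hall (3 * W₀ + j) (by omega), ?_⟩
    funext t ρ
    simp only [Ψ, wordAt, Y, hxpt]
    rw [det_add_left, det_smul_left, det_self, mul_zero, add_zero, hb'u, det_add_right,
      det_smul_right, hz]
    congr 2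
    push_cast
    ring
  have hMH := morse_hedlund Y s ((hambfin.image _).subset hrange)
    ((Set.ncard_le_ncard hrange (hambfin.image _)).trans
      ((Set.ncard_image_le hambfin).trans (by omega)))
  intro a ha1 ha2 i hi
  push_cast at hi
  have hρ : (a + N).toNat < N.toNat := by omega
  have h1 := abs_le.1 (hb'W ⟨_, hρ⟩)
  have h2 := congrFun (hMH (i - 3 * W₀ - det z (b' ⟨_, hρ⟩)).toNat (by omega)) ⟨_, hρ⟩
  simp only [Y] at h2
  push_cast at h2
  rw [Int.toNat_of_nonneg (by omega), Int.toNat_of_nonneg (by omega)] at h2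
  convert h2 using 3
  · omega
  · ring
  · omega
  · ring

/-- Each difference costs `|l a|` of thickness. By induction `D_a G` vanishes everywhere, and the
`a`-periodic `G` is then determined by the strip. -/
theorem eq_zero_of_diffList_of_strip (l : ℤ × ℤ →+ ℤ) {L : List (ℤ × ℤ)} {G : ℤ × ℤ → ℤ} {s : ℤ}
    (hL : ∀ a ∈ L, l a ≠ 0) (hG : diffList L G = fun _ => 0)
    (h0 : ∀ x, s ≤ l x → l x < s + (L.map fun a => |l a|).sum → G x = 0) : ∀ x, G x = 0 := by
  induction L generalizing G s with
  | nil => exact congrFun hG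
  | cons a L ih =>
    have ha := hL a (by simp)
    have hL' : ∀ b ∈ L, l b ≠ 0 := fun b hb => hL b (List.mem_cons_of_mem _ hb)
    rw [List.map_cons, List.sum_cons] at h0
    have hpos : 0 ≤ (L.map fun a => |l a|).sum := by
      refine List.sum_nonneg fun y hy => ?_
      obtain ⟨b, -, rfl⟩ := List.mem_map.1 hy
      exact abs_nonneg _
    rw [diffList_cons, ← diffList_diffBy] at hG
    have h1 : ∀ x, diffBy a G x = 0 := by
      rcases lt_or_gt_of_ne ha with hneg | hlt
      · refine ih (s := s + |l a|) hL' hG fun x hx1 hx2 => ?_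
        have : |l a| = - l a := abs_of_neg hneg
        simp only [diffBy]
        rw [h0 x (by linarith) (by linarith), h0 (x + a) (by rw [map_add]; linarith)
          (by rw [map_add]; linarith), sub_zero]
      · refine ih (s := s) hL' hG fun x hx1 hx2 => ?_
        have : |l a| = l a := abs_of_pos hlt
        simp only [diffBy]
        rw [h0 x (by linarith) (by linarith), h0 (x + a) (by rw [map_add]; linarith)
          (by rw [map_add]; linarith), sub_zero]
    exact eq_zero_of_periodic_of_strip l (s := s) (diffBy_eq_zero_iff.1 (funext h1)) ha
      fun x hx1 hx2 => h0 x hx1 (by linarith)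

theorem exists_primitive {u : ℤ × ℤ} (hu : u ≠ 0) :
    ∃ (m : ℕ) (u' z : ℤ × ℤ), 0 < m ∧ u = (m : ℤ) • u' ∧ det z u' = 1 := by
  have hpos : 0 < Int.gcd u.1 u.2 := by
    rw [Int.gcd_pos_iff]
    by_contra! h
    exact hu (Prod.ext h.1 h.2)
  obtain ⟨a, ha⟩ := Int.gcd_dvd_left u.1 u.2
  obtain ⟨b, hb⟩ := Int.gcd_dvd_right u.1 u.2
  have hbez := Int.gcd_eq_gcd_ab u.1 u.2
  refine ⟨Int.gcd u.1 u.2, (a, b), (Int.gcdB u.1 u.2, - Int.gcdA u.1 u.2), hpos,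
    Prod.ext ha hb, ?_⟩
  have hne : ((Int.gcd u.1 u.2 : ℕ) : ℤ) ≠ 0 := by exact_mod_cast hpos.ne'
  apply mul_left_cancel₀ hne
  simp only [det]
  generalize Int.gcdA u.1 u.2 = s at *
  generalize Int.gcdB u.1 u.2 = t at *
  calc ((Int.gcd u.1 u.2 : ℕ) : ℤ) * (t * b - -s * a)
      = (Int.gcd u.1 u.2 : ℤ) * a * s + (Int.gcd u.1 u.2 : ℤ) * b * t := by ring
    _ = u.1 * s + u.2 * t := by rw [← ha, ← hb]
    _ = _ := by rw [mul_one]; exact hbez.symm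

theorem hasFaces_smul_iff {c : ℤ × ℤ → ℤ} {u : ℤ × ℤ} {m : ℕ} (hm : 0 < m) :
    HasFaces c ((m : ℤ) • u) ↔ HasFaces c u := by
  have hm' : (0 : ℤ) < m := by exact_mod_cast hm
  simp only [HasFaces, det_smul_right, mul_right_inj' hm'.ne', mul_le_mul_iff_right₀ hm']

theorem MinAnnihilates.hasFaces {c : ℤ × ℤ → ℤ} (hc : (Set.range c).Finite) {u v : ℤ × ℤ}
    {L : List (ℤ × ℤ)} (h : MinAnnihilates (u :: v :: L) c) : HasFaces c u := by
  obtain ⟨m, u', z, hm, rfl, hz⟩ := exists_primitive (h.1.1 u (by simp))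
  rw [hasFaces_smul_iff hm]
  exact fun B F K hrel hF => h.exists_face hc hz hrel hF

/-- Coordinate-free form of `exists_ray_core`, with `μ` measuring height along the ray. The order of
quantifiers matters: `M` is uniform, and `κ` does not depend on `h`, so rays can be lengthened
downward at will. -/
theorem exists_ray {c : ℤ × ℤ → ℤ} (hc : (Set.range c).Finite) {n : ℕ}
    (hP : complexity c (rectangle n 3) ≤ n * 3) {u : ℤ × ℤ} (hface : HasFaces c u)
    (μ : ℤ × ℤ →+ ℤ) (hμ : 0 < μ u) (w : ℕ) :
    ∃ M : ℕ, 0 < M ∧ ∀ f ∈ limits c, ∀ g ∈ limits c, ∀ C : ℤ, ∃ κ : ℤ, ∀ h : ℤ,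
      (∀ x, det x u < C → h ≤ μ x → f x = g x) →
      (∀ x, det x u = C → h ≤ μ x → f (x + u) - g (x + u) = f x - g x) →
      (∃ x, det x u = C ∧ h ≤ μ x ∧ f x ≠ g x) →
      ∀ x, C - w ≤ det x u → det x u < C → h + κ ≤ μ x → f (x + (M : ℤ) • u) = f x := by
  have hu : u ≠ 0 := by rintro rfl; simp at hμ
  obtain ⟨m, u, z, hm, rfl, hz⟩ := exists_primitive hu
  rw [hasFaces_smul_iff hm] at hface
  have hm' : (0 : ℤ) < m := by exact_mod_cast hm
  rw [map_zsmul, smul_eq_mul] at hμ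
  have hμ' : 0 < μ u := pos_of_mul_pos_right hμ hm'.le
  obtain ⟨M, hM, κ₀, W, hcore⟩ := exists_ray_core hc hz hP hface hm w
  refine ⟨M, hM, fun f hf g hg C => ?_⟩
  set A : ℤ := |C / m| with hA
  refine ⟨(A + W) * |μ z| + μ u + κ₀ * μ u + (A + w) * |μ z|, fun h h1 h2 h3 => ?_⟩
  obtain ⟨x₀, hx₀, hμx₀, hne⟩ := h3
  simp only [det_smul_right] at h1 h2 hx₀ ⊢
  set C' := det x₀ u with hC'
  have hCA : A = |C'| := by rw [hA, ← hx₀, Int.mul_ediv_cancel_left _ hm'.ne']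
  have hμpt : ∀ a i, μ (pt z u a i) = a * μ z + i * μ u := by
    intro a i
    rw [pt, map_add, map_zsmul, map_zsmul, smul_eq_mul, smul_eq_mul]
  have hdpt : ∀ a i, det (pt z u a i) u = a := by
    intro a i
    rw [pt, det_add_left, det_smul_left, det_smul_left, det_self, hz]; ring
  have habs : ∀ a (B : ℤ), |a| ≤ B → |a * μ z| ≤ B * |μ z| := fun a B ha => by
    rw [abs_mul]
    exact mul_le_mul_of_nonneg_right ha (abs_nonneg _)
  -- Above level `i₀`, all points of the columns from `C' - W` to `C'` have height at least `h`.
  set i₀ := (h + (A + W) * |μ z|) / μ u + 1 with hi₀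
  have hi₀1 : h + (A + W) * |μ z| < i₀ * μ u := Int.lt_ediv_add_one_mul_self _ hμ'
  have hi₀2 : i₀ * μ u ≤ h + (A + W) * |μ z| + μ u := by
    rw [hi₀, add_mul, one_mul]
    linarith [Int.ediv_mul_le (h + (A + W) * |μ z|) hμ'.ne']
  have hbig : ∀ a i, C' - W ≤ a → a ≤ C' → i₀ ≤ i → h ≤ μ (pt z u a i) := by
    intro a i ha1 ha2 hi
    have h4 := abs_le.1 (habs a (A + W) (by
      rw [hCA, abs_le]; have := neg_abs_le C'; have := le_abs_self C'; constructor <;> omega))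
    rw [hμpt]
    have := mul_le_mul_of_nonneg_right hi hμ'.le
    linarith
  have hshift : ∀ a i, pt z u a i + pt z u C' i₀ = pt z u (a + C') (i + i₀) := by
    intro a i
    simp only [pt]; module
  have hper : ∀ k : ℕ, f (x₀ + (k : ℤ) • (m : ℤ) • u) - g (x₀ + (k : ℤ) • (m : ℤ) • u) =
      f x₀ - g x₀ := by
    intro k
    induction k with
    | zero => simp
    | succ k ih =>
      rw [← ih, ← h2 (x₀ + (k : ℤ) • (m : ℤ) • u)]
      · push_cast
        rw [add_smul, one_smul, add_assoc]
      · rw [det_add_left, det_smul_left, det_smul_left, det_self]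
        linarith
      · rw [map_add, map_zsmul, map_zsmul, smul_eq_mul, smul_eq_mul]
        have : 0 ≤ (k : ℤ) * (m * μ u) := by positivity
        linarith
  have key := hcore _ (mem_limits_translate hf (pt z u C' i₀)) _
    (mem_limits_translate hg (pt z u C' i₀))
    (by
      intro a i ha1 ha2 hi
      rw [hshift]
      refine h1 _ ?_ (hbig _ _ (by omega) (by omega) (by omega))
      rw [hdpt, ← hx₀]
      exact mul_lt_mul_of_pos_left (by omega) hm')
    (by
      intro i hi
      have h5 := h2 (pt z u (0 + C') (i + i₀)) (by rw [hdpt, zero_add, hx₀])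
        (hbig _ _ (by omega) (by omega) (by omega))
      have h6 : pt z u (0 + C') (i + i₀) + (m : ℤ) • u = pt z u (0 + C') (i + m + i₀) := by
        simp only [pt]; module
      rw [h6] at h5
      simp only [hshift]
      exact h5)
    (by
      have hx₀' := eq_pt hz x₀
      refine ⟨det z x₀ + ((i₀ - det z x₀).toNat : ℕ) * m - i₀, ?_, ?_⟩
      · have : ((i₀ - det z x₀).toNat : ℤ) * 1 ≤ ((i₀ - det z x₀).toNat : ℤ) * m :=
          mul_le_mul_of_nonneg_left (by omega) (by omega)
        omega
      · rw [hshift, ← sub_ne_zero]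
        have h6 : pt z u (0 + C') (det z x₀ + ((i₀ - det z x₀).toNat : ℕ) * m - i₀ + i₀) =
            x₀ + ((i₀ - det z x₀).toNat : ℤ) • (m : ℤ) • u := by
          generalize (i₀ - det z x₀).toNat = k
          conv_rhs => rw [hx₀']
          simp only [pt]; module
        rw [h6, hper]
        exact sub_ne_zero.2 hne)
  intro x hx1 hx2 hx3
  rw [← hx₀] at hx1 hx2
  have hx2' : det x u < C' := lt_of_mul_lt_mul_left hx2 hm'.le
  have hx1' : C' - w ≤ det x u := by
    by_contra! hlt
    nlinarith [Int.natCast_nonneg w]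
  have hi : i₀ + κ₀ ≤ det z x := by
    have h4 := abs_le.1 (habs (det x u) (A + w) (by
      rw [hCA, abs_le]; have := neg_abs_le C'; have := le_abs_self C'; constructor <;> omega))
    have h5 : μ x = det x u * μ z + det z x * μ u := by
      conv_lhs => rw [eq_pt hz x]
      rw [hμpt]
    refine le_of_mul_le_mul_right ?_ hμ'
    rw [add_mul]
    linarith
  have hstep : ∀ k : ℕ, f (x + (k : ℤ) • (M : ℤ) • u) = f x := by
    intro k
    induction k with
    | zero => simp
    | succ k ih =>
      rw [← ih]
      have h5 := key (det x u - C') (det z x + k * M - i₀) (by omega) (by omega) (by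
        have : 0 ≤ (k : ℤ) * M := by positivity
        omega)
      rw [hshift, hshift] at h5
      convert h5 using 2
      · conv_lhs => rw [eq_pt hz x]
        simp only [pt]; push_cast; module
      · conv_lhs => rw [eq_pt hz x]
        simp only [pt]; module
  have := hstep m
  rwa [smul_comm] at this

/-! ### Limits along a direction -/

/-- The limits of the translates of `c` by multiples of `u`. -/
def directionalLimits (u : ℤ × ℤ) (c : ℤ × ℤ → ℤ) : Set (ℤ × ℤ → ℤ) :=
  {f | ∀ B : Finset (ℤ × ℤ), ∃ k : ℤ, ∀ x ∈ B, f x = c (x + k • u)}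

theorem directionalLimits_subset (u : ℤ × ℤ) (c : ℤ × ℤ → ℤ) :
    directionalLimits u c ⊆ limits c := fun _ hf B =>
  let ⟨k, hk⟩ := hf B
  ⟨k • u, hk⟩

/-- `D_L c` is `u`-periodic, so limits along `u` do not change it. This carries properties of a
limit back to `c`. -/
theorem diffList_of_mem_directionalLimits {u : ℤ × ℤ} {c f : ℤ × ℤ → ℤ} {L : List (ℤ × ℤ)}
    (h : diffList (u :: L) c = fun _ => 0) (hf : f ∈ directionalLimits u c) :
    diffList L f = diffList L c := by
  funext x
  obtain ⟨B, hB⟩ := diffList_local L x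
  obtain ⟨k, hk⟩ := hf B
  rw [hB f (fun y => c (y + k • u)) hk, diffList_translate]
  exact periodic_zsmul (diffBy_eq_zero_iff.1 h) k x

/-- A linear functional independent of `det u`. -/
def dotHom (u : ℤ × ℤ) : ℤ × ℤ →+ ℤ :=
  AddMonoidHom.mk' (fun x => u.1 * x.1 + u.2 * x.2) fun x y => by
    simp only [Prod.fst_add, Prod.snd_add]; ring

theorem dotHom_self_pos {u : ℤ × ℤ} (hu : u ≠ 0) : 0 < dotHom u u := by
  show 0 < u.1 * u.1 + u.2 * u.2
  have h1 := mul_self_nonneg u.1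
  have h2 := mul_self_nonneg u.2
  by_contra! h
  exact hu (Prod.ext (mul_self_eq_zero.1 (by linarith)) (mul_self_eq_zero.1 (by linarith)))

theorem dotHom_self_mul_det (u v x : ℤ × ℤ) :
    dotHom u u * det x v = det u v * dotHom u x - dotHom u v * det u x := by
  show (u.1 * u.1 + u.2 * u.2) * det x v =
    det u v * (u.1 * x.1 + u.2 * x.2) - (u.1 * v.1 + u.2 * v.2) * det u x
  simp only [det]; ring

theorem finite_strip {u : ℤ × ℤ} (hu : u ≠ 0) (r s t : ℤ) :
    {x : ℤ × ℤ | (0 ≤ det u x ∧ det u x < r) ∧ s ≤ dotHom u x ∧ dotHom u x < t}.Finite := by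
  refine Set.Finite.subset (((Set.finite_Ico 0 r).prod (Set.finite_Ico s t)).preimage
    (f := fun x => (det u x, dotHom u x)) ?_) fun x hx => hx
  intro x _ y _ hxy
  obtain ⟨h1, h2⟩ := Prod.ext_iff.1 hxy
  have h3 := (dotHom_self_pos hu).ne'
  have h4 := fun v => dotHom_self_mul_det u v (x - y)
  simp only [map_sub, det_sub_right] at h1 h2 h4
  simp only [h1, h2, sub_self, mul_zero] at h4
  have h5 := fun v => (mul_eq_zero.1 (h4 v)).resolve_left h3
  have h6 := h5 (0, 1)
  have h7 := h5 (1, 0)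
  simp only [det, Prod.fst_sub, Prod.snd_sub] at h6 h7
  exact Prod.ext (by omega) (by omega)

/-- If some long block of the strip always determined its continuation, the strip would be periodic.
So for every length there are two equal blocks with different continuations; let the length tend to
infinity. -/
theorem exists_pair {c : ℤ × ℤ → ℤ} (hc : (Set.range c).Finite) {u : ℤ × ℤ} (hu : u ≠ 0) {r : ℤ}
    (h : ∀ q : ℤ, 0 < q → ∃ x, (0 ≤ det u x ∧ det u x < r) ∧ c (x + q • u) ≠ c x) :
    ∃ f ∈ directionalLimits u c, ∃ g ∈ directionalLimits u c,
      (∀ x, 0 ≤ det u x → det u x < r → dotHom u x < 0 → f x = g x) ∧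
      ∃ x, (0 ≤ det u x ∧ det u x < r) ∧ f x ≠ g x := by
  classical
  set N := dotHom u u with hN
  have hNpos : 0 < N := dotHom_self_pos hu
  have hdet : ∀ (x : ℤ × ℤ) (k : ℤ), det u (x + k • u) = det u x := by
    intro x k
    rw [det_add_right, det_smul_right, det_self, mul_zero, add_zero]
  have hdot : ∀ (x : ℤ × ℤ) (k : ℤ), dotHom u (x + k • u) = dotHom u x + k * N := by
    intro x k
    rw [map_add, map_zsmul, smul_eq_mul]
  have hblock : ∀ K : ℕ, ∃ i j : ℤ,
      (∀ x, 0 ≤ det u x → det u x < r → -(K + 1) * N ≤ dotHom u x → dotHom u x < 0 →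
        c (x + i • u) = c (x + j • u)) ∧
      ∃ x, (0 ≤ det u x ∧ det u x < r) ∧ 0 ≤ dotHom u x ∧ dotHom u x < N ∧
        c (x + i • u) ≠ c (x + j • u) := by
    intro K
    set B := (finite_strip hu r (-(K + 1) * N) 0).toFinset with hB
    have hmem : ∀ x, x ∈ B ↔ (0 ≤ det u x ∧ det u x < r) ∧ -(K + 1) * N ≤ dotHom u x ∧
        dotHom u x < 0 := fun x => Set.Finite.mem_toFinset _
    let s : ℤ → words c B := fun k => ⟨_, ⟨k • u, rfl⟩⟩
    have hs : ∀ i j, s i = s j ↔ ∀ x ∈ B, c (x + i • u) = c (x + j • u) := by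
      intro i j
      rw [Subtype.ext_iff, funext_iff]
      exact ⟨fun h x hx => h ⟨x, hx⟩, fun h x => h x x.2⟩
    have : Finite (words c B) := words_finite hc B
    by_contra! hcon
    obtain ⟨q, hq, hper⟩ := int_periodic_of_deterministic s (by
      intro i j hij
      rw [hs] at hij ⊢
      intro y hy
      obtain ⟨hy1, hy2, hy3⟩ := (hmem y).1 hy
      have h1 : ∀ k : ℤ, y + (k + 1) • u = (y + (1 : ℤ) • u) + k • u := fun k => by module
      rw [h1, h1]
      by_cases hlt : dotHom u (y + (1 : ℤ) • u) < 0
      · refine hij _ ((hmem _).2 ⟨by rwa [hdet], ?_, hlt⟩)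
        rw [hdot]; linarith
      · refine hcon i j (fun x hx1 hx2 hx3 hx4 => hij x ((hmem x).2 ⟨⟨hx1, hx2⟩, hx3, hx4⟩)) _
          (by rwa [hdet]) (not_lt.1 hlt) ?_
        rw [hdot]; linarith)
    obtain ⟨x, hx, hne⟩ := h q (by exact_mod_cast hq)
    apply hne
    set k := - (dotHom u x / N) - 1 with hk
    have h1 := Int.emod_add_mul_ediv (dotHom u x) N
    have h2 := Int.emod_nonneg (dotHom u x) hNpos.ne'
    have h3 := Int.emod_lt_of_pos (dotHom u x) hNpos
    have h4 := (hs _ _).1 (hper (-k)) (x + k • u) ((hmem _).2 ⟨by rwa [hdet], by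
      rw [hdot, hk]
      have : 0 ≤ (K : ℤ) * N := by positivity
      linarith, by
      rw [hdot, hk]; linarith⟩)
    rwa [show x + k • u + (-k + (q : ℤ)) • u = x + (q : ℤ) • u by module,
      show x + k • u + -k • u = x by module] at h4
  choose i j hagree hne using hblock
  obtain ⟨F, hF⟩ := exists_limit (ι := Bool × (ℤ × ℤ))
    (fun K p => c (p.2 + (if p.1 then i K else j K) • u)) hc (fun K p => ⟨_, rfl⟩)
  refine ⟨fun x => F (true, x), fun B => ?_, fun x => F (false, x), fun B => ?_, ?_, ?_⟩
  · obtain ⟨K, -, hK⟩ := hF (B.image fun x => (true, x)) 0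
    exact ⟨i K, fun x hx => hK (true, x) (Finset.mem_image_of_mem _ hx)⟩
  · obtain ⟨K, -, hK⟩ := hF (B.image fun x => (false, x)) 0
    exact ⟨j K, fun x hx => hK (false, x) (Finset.mem_image_of_mem _ hx)⟩
  · intro x hx1 hx2 hx3
    obtain ⟨K, hKle, hK⟩ := hF {(true, x), (false, x)} (-dotHom u x).toNat
    show F (true, x) = F (false, x)
    rw [hK (true, x) (by simp), hK (false, x) (by simp)]
    refine hagree K x hx1 hx2 ?_ hx3
    have h1 : (-dotHom u x) ≤ K := by omega
    nlinarith
  · set P := (finite_strip hu r 0 N).toFinset with hP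
    obtain ⟨K, -, hK⟩ := hF (Finset.univ ×ˢ P) 0
    obtain ⟨x, hx1, hx2, hx3, hx4⟩ := hne K
    have hxP : x ∈ P := (Set.Finite.mem_toFinset _).2 ⟨hx1, hx2, hx3⟩
    refine ⟨x, hx1, ?_⟩
    show F (true, x) ≠ F (false, x)
    rw [hK (true, x) (by simp [hxP]), hK (false, x) (by simp [hxP])]
    exact hx4

/-! ### Two annihilating directions are impossible. -/

theorem MinAnnihilates.det_ne_zero_of_mem {c : ℤ × ℤ → ℤ} (hc : (Set.range c).Finite)
    {u a : ℤ × ℤ} {L : List (ℤ × ℤ)} (h : MinAnnihilates (u :: L) c) (ha : a ∈ L) :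
    det u a ≠ 0 :=
  (h.perm ((List.perm_cons_erase ha).cons u)).det_ne_zero hc

theorem exists_strip_bound {u v : ℤ × ℤ} (hu : u ≠ 0) (hv : 0 < det u v) (r t : ℤ) :
    ∃ b : ℤ, ∀ x, 0 ≤ det u x → det u x < r → det x v ≤ b → dotHom u x < t := by
  refine ⟨-(|dotHom u v| * |r| + det u v * |t| + 1), fun x hx1 hx2 hx3 => ?_⟩
  have hN := dotHom_self_pos hu
  have h1 := dotHom_self_mul_det u v x
  have h2 : dotHom u v * det u x ≤ |dotHom u v| * |r| :=
    (le_abs_self _).trans (by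
      rw [abs_mul]
      refine mul_le_mul_of_nonneg_left ?_ (abs_nonneg _)
      rw [abs_of_nonneg hx1]
      exact hx2.le.trans (le_abs_self r))
  have h3 : det x v < 0 := by
    have : 0 ≤ |dotHom u v| * |r| := by positivity
    have : 0 ≤ det u v * |t| := by positivity
    omega
  have h4 : dotHom u u * det x v ≤ det x v := by nlinarith
  have h5 : det u v * -|t| ≤ det u v * t := mul_le_mul_of_nonneg_left (neg_abs_le t) hv.le
  refine lt_of_mul_lt_mul_left (a := det u v) ?_ hv.le
  linarith

/-- The strip is at least `det u v` thick, so multiples of `v` bring every point into it. The zeros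
on the half-strip thus fill a half-plane bounded by a line parallel to `v`. -/
theorem exists_leftmost_line {u v : ℤ × ℤ} (hu : u ≠ 0) (hv : 0 < det u v) {r t : ℤ}
    (hr : det u v ≤ r) {G : ℤ × ℤ → ℤ} (hper : ∀ x, G (x + v) = G x)
    (h0 : ∀ x, 0 ≤ det u x → det u x < r → dotHom u x < t → G x = 0) (hne : ∃ x, G x ≠ 0) :
    ∃ C, (∀ x, det x v < C → G x = 0) ∧ ∃ x, det x v = C ∧ G x ≠ 0 := by
  obtain ⟨b, hb⟩ := exists_strip_bound hu hv r t
  obtain ⟨x₀, hx₀⟩ := hne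
  obtain ⟨C, ⟨x, hx, hGx⟩, hleast⟩ := Int.exists_least_of_bdd
    (P := fun C => ∃ x, det x v = C ∧ G x ≠ 0)
    ⟨b, by
      rintro _ ⟨x, rfl, hGx⟩
      by_contra! hlt
      apply hGx
      have h1 := Int.emod_add_mul_ediv (det u x) (det u v)
      have h2 := Int.emod_nonneg (det u x) hv.ne'
      have h3 := Int.emod_lt_of_pos (det u x) hv
      set k := det u x / det u v
      rw [← periodic_zsmul hper (-k)]
      have h4 : det u (x + -k • v) = det u x - det u v * k := by
        rw [det_add_right, det_smul_right]; ring
      refine h0 _ (by linarith) (by linarith) (hb _ (by linarith) (by linarith) ?_)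
      rw [det_add_left, det_smul_left, det_self]
      linarith⟩
    ⟨_, x₀, rfl, hx₀⟩
  refine ⟨C, fun y hy => ?_, x, hx, hGx⟩
  by_contra hGy
  exact absurd (hleast _ ⟨y, rfl, hGy⟩) (not_le.2 hy)

/-- A period along `u` on so thick a strip would spread to the whole plane, because the other
factors annihilate `D_(q u) c`. -/
theorem MinAnnihilates.exists_pair {c : ℤ × ℤ → ℤ} (hc : (Set.range c).Finite) {u v : ℤ × ℤ}
    {L : List (ℤ × ℤ)} (h : MinAnnihilates (u :: v :: L) c) {r : ℤ}
    (hr : ((v :: L).map fun a => |det u a|).sum ≤ r) :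
    ∃ f ∈ directionalLimits u c, ∃ g ∈ directionalLimits u c,
      (∀ x, 0 ≤ det u x → det u x < r → dotHom u x < 0 → f x = g x) ∧
      ∃ x, (0 ≤ det u x ∧ det u x < r) ∧ f x ≠ g x := by
  refine Nivat.exists_pair hc (h.1.1 u (by simp)) fun q hq => ?_
  by_contra! hper
  have h1 : diffBy (q • u) c = fun _ => 0 := by
    refine funext (eq_zero_of_diffList_of_strip (detHom u) (L := v :: L) (s := 0)
      (fun a ha => h.det_ne_zero_of_mem hc ha) ?_ fun x hx1 hx2 => ?_)
    · rw [diffList_diffBy]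
      exact diffBy_zsmul_eq_zero h.1.2 q
    · rw [zero_add] at hx2
      exact sub_eq_zero.2 (hper x ⟨hx1, lt_of_lt_of_le hx2 hr⟩)
  refine (h.perm (List.Perm.swap v u L)).not_periodic hc hq.ne' ?_
  rw [← diffList_diffBy, h1]
  exact diffList_zero _

/-- The leftmost line where `f` and `g` differ is a ray in the sense of `exists_ray` from every
starting height. Hence `f` is periodic along `v` on a full strip, then everywhere, and the period
passes to `D_(v :: L) c`. -/
theorem MinAnnihilates.false_of_periodic_sub {c : ℤ × ℤ → ℤ} (hc : (Set.range c).Finite) {n : ℕ}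
    (hP : complexity c (rectangle n 3) ≤ n * 3) {u v : ℤ × ℤ} {L : List (ℤ × ℤ)}
    (h : MinAnnihilates (u :: v :: L) c) (hv : 0 < det u v) {r : ℤ} (hr : det u v ≤ r)
    {f g : ℤ × ℤ → ℤ} (hf : f ∈ directionalLimits u c) (hg : g ∈ directionalLimits u c)
    (hfg : ∀ x, 0 ≤ det u x → det u x < r → dotHom u x < 0 → f x = g x) (hne : ∃ x, f x ≠ g x)
    (hper : ∀ x, f (x + v) - g (x + v) = f x - g x) : False := by
  have hu : u ≠ 0 := h.1.1 u (by simp)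
  have h' := h.perm (List.Perm.swap v u L)
  have hf' := directionalLimits_subset u c hf
  obtain ⟨C, hC, x₀, hx₀, hGx₀⟩ := exists_leftmost_line hu hv hr (G := fun x => f x - g x) hper
    (fun x h1 h2 h3 => sub_eq_zero.2 (hfg x h1 h2 h3))
    (let ⟨x, hx⟩ := hne; ⟨x, sub_ne_zero.2 hx⟩)
  set l := detHom (-v) with hl
  have hlx : ∀ x, l x = det x v := fun x => by
    rw [hl, detHom_apply, det_neg_left, det_swap, neg_neg]
  obtain ⟨M, hM, hray⟩ := exists_ray hc hP (h'.hasFaces hc) (detHom u) hv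
    ((u :: L).map fun a => |l a|).sum.toNat
  obtain ⟨κ, hκ⟩ := hray f hf' g (directionalLimits_subset u c hg) C
  have h1 : diffBy ((M : ℤ) • v) f = fun _ => 0 := by
    refine funext (eq_zero_of_diffList_of_strip l (L := u :: L)
      (s := C - ((u :: L).map fun a => |l a|).sum)
      (fun a ha => ?_) ?_ fun x hx1 hx2 => ?_)
    · rw [hlx, det_swap]
      exact neg_ne_zero.2 (h'.det_ne_zero_of_mem hc ha)
    · rw [diffList_diffBy]
      exact diffBy_zsmul_eq_zero (diffList_of_mem_limits hf' h'.1.2) M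
    · rw [hlx] at hx1 hx2
      -- The starting height is chosen after `x`, just low enough for the periodic part to reach
      -- `x`.
      refine sub_eq_zero.2 (hκ (det u x - κ) (fun y hy _ => sub_eq_zero.1 (hC y hy))
        (fun y _ _ => hper y) ?_ x (by omega) (by omega) (by rw [detHom_apply]; omega))
      refine ⟨x₀ + ((det u x - κ - det u x₀).toNat : ℤ) • v, ?_, ?_, ?_⟩
      · rw [det_add_left, det_smul_left, det_self, mul_zero, add_zero, hx₀]
      · rw [detHom_apply, det_add_right, det_smul_right]
        have h2 : ((det u x - κ - det u x₀).toNat : ℤ) * 1 ≤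
            ((det u x - κ - det u x₀).toNat : ℤ) * det u v :=
          mul_le_mul_of_nonneg_left (by omega) (by omega)
        omega
      · rw [← sub_ne_zero]
        exact (periodic_zsmul (f := fun x => f x - g x) hper _ x₀).trans_ne hGx₀
  refine h.not_periodic hc (M := M) (by exact_mod_cast hM.ne') ?_
  rw [← diffList_of_mem_directionalLimits h.1.2 hf, ← diffList_diffBy, h1]
  exact diffList_zero _

theorem not_minAnnihilates_pair {c : ℤ × ℤ → ℤ} (hc : (Set.range c).Finite) {n : ℕ}
    (hP : complexity c (rectangle n 3) ≤ n * 3) {u v : ℤ × ℤ} : ¬ MinAnnihilates [u, v] c := by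
  intro h
  wlog hv : 0 < det u v generalizing v
  · refine this (v := -v) (((h.perm (List.Perm.swap v u [])).neg_cons).perm
      (List.Perm.swap u (-v) [])) ?_
    have := h.det_ne_zero hc
    rw [det_neg_right]
    omega
  obtain ⟨f, hf, g, hg, hfg, x, -, hx⟩ := h.exists_pair hc (r := det u v)
    (by simp [abs_of_pos hv])
  refine h.false_of_periodic_sub hc hP hv le_rfl hf hg hfg ⟨x, hx⟩ fun y => ?_
  have h1 := congrFun ((diffList_of_mem_directionalLimits h.1.2 hf).trans
    (diffList_of_mem_directionalLimits h.1.2 hg).symm) y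
  simp only [diffList_cons, diffList_nil, diffBy] at h1
  linarith

/-! ### With three annihilating directions, none is expansive. -/

theorem det_add_smul_left (x u v : ℤ × ℤ) (k : ℤ) :
    det (x + k • u) v = det x v + k * det u v := by
  rw [det_add_left, det_smul_left]

theorem det_add_smul_right (x u v : ℤ × ℤ) (k : ℤ) :
    det u (x + k • v) = det u x + k * det u v := by
  rw [det_add_right, det_smul_right]

/-- A function killed by the differences along `u` and `v` that vanishes on a thick ray vanishes
on the sector to the left of it. -/
theorem eq_zero_on_sector {u v t : ℤ × ℤ} (huv : 0 < det u v) (hut : 0 < det u t)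
    (hvt : 0 < det v t) {G : ℤ × ℤ → ℤ} (hG : diffBy u (diffBy v G) = fun _ => 0) {C h : ℤ}
    (h0 : ∀ x, C - (det u t + det v t) ≤ det x t → det x t < C → h ≤ det u x → G x = 0) :
    ∀ x, det x t < C → h ≤ det u x → G x = 0 := by
  rw [diffBy_comm] at hG
  -- `diffBy u G` is `v`-periodic, and steps along `v` raise both `det · t` and `det u ·`, so they
  -- lead into the thick ray. Below, steps along `u` do the same for `G`.
  have h1 : ∀ x, det x t < C - det u t → h ≤ det u x → diffBy u G x = 0 := by
    intro x hx1 hx2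
    have e1 := Int.emod_add_mul_ediv (C - det u t - 1 - det x t) (det v t)
    have e2 := Int.emod_nonneg (C - det u t - 1 - det x t) hvt.ne'
    have e3 := Int.emod_lt_of_pos (C - det u t - 1 - det x t) hvt
    have e4 : 0 ≤ (C - det u t - 1 - det x t) / det v t := Int.ediv_nonneg (by omega) hvt.le
    set k := (C - det u t - 1 - det x t) / det v t
    rw [← periodic_zsmul (diffBy_eq_zero_iff.1 hG) k]
    have e5 := mul_nonneg e4 huv.le
    simp only [diffBy]
    rw [h0 (x + k • v), h0 (x + k • v + u), sub_zero]
    all_goals simp only [det_add_left, det_smul_left, det_add_right, det_smul_right, det_self]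
    all_goals linarith
  intro x hx1 hx2
  have hstep : ∀ k : ℕ, det x t + k * det u t < C → G (x + (k : ℤ) • u) = G x := by
    intro k
    induction k with
    | zero => simp
    | succ k ih =>
      intro hk
      push_cast at hk ⊢
      rw [← ih (by linarith), ← sub_eq_zero, add_smul, one_smul, ← add_assoc]
      refine h1 _ ?_ ?_
      · rw [det_add_smul_left]; linarith
      · rw [det_add_smul_right, det_self]; linarith
  have e1 := Int.emod_add_mul_ediv (C - 1 - det x t) (det u t)
  have e2 := Int.emod_nonneg (C - 1 - det x t) hut.ne'
  have e3 := Int.emod_lt_of_pos (C - 1 - det x t) hut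
  have e4 : 0 ≤ (C - 1 - det x t) / det u t := Int.ediv_nonneg (by omega) hut.le
  obtain ⟨k, hk⟩ := Int.eq_ofNat_of_zero_le e4
  rw [hk] at e1
  rw [← hstep k (by linarith)]
  apply h0
  · rw [det_add_smul_left]; linarith
  · rw [det_add_smul_left]; linarith
  · rw [det_add_smul_right, det_self]; linarith

/-- The direction `u` is expansive for the limits of `c`. -/
def IsExpansive (u : ℤ × ℤ) (c : ℤ × ℤ → ℤ) : Prop :=
  ∃ r : ℤ, ∀ f ∈ limits c, ∀ g ∈ limits c, (∀ x, |det u x| ≤ r → f x = g x) → f = g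

theorem exists_directionalLimit {f : ℤ × ℤ → ℤ} (hf : (Set.range f).Finite) (u : ℤ × ℤ) :
    ∃ f' ∈ directionalLimits u f, ∀ (B : Finset (ℤ × ℤ)) (k₀ : ℕ),
      ∃ k : ℕ, k₀ ≤ k ∧ ∀ x ∈ B, f' x = f (x + (-(k : ℤ)) • u) := by
  obtain ⟨f', hf'⟩ := exists_limit (fun k x => f (x + (-(k : ℤ)) • u)) hf fun k x => ⟨_, rfl⟩
  exact ⟨f', fun B => let ⟨k, _, hk⟩ := hf' B 0; ⟨_, hk⟩, hf'⟩

/-- Here `f - g` need not be `v`-periodic, but `D_v (f - g)` is `t`-periodic. Its leftmost line,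
shifted by `v`, carries a ray along `t` that makes `f` periodic on a sector. A limit along `-u` and
expansiveness of `u` make the period global. -/
theorem not_minAnnihilates_of_isExpansive {c : ℤ × ℤ → ℤ} (hc : (Set.range c).Finite) {n : ℕ}
    (hP : complexity c (rectangle n 3) ≤ n * 3) {u v t : ℤ × ℤ} (hexp : IsExpansive u c)
    (huv : 0 < det u v) (hut : 0 < det u t) (hvt : 0 < det v t) :
    ¬ MinAnnihilates [u, v, t] c := by
  intro h
  have hu : u ≠ 0 := h.1.1 u (by simp)
  have ht : MinAnnihilates [t, u, v] c :=
    h.perm ((List.Perm.swap t v []).cons u |>.trans (List.Perm.swap t u [v]))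
  obtain ⟨f, hf, g, hg, hfg, hne⟩ := h.exists_pair hc (r := det u v + det u t)
    (by simp [abs_of_pos huv, abs_of_pos hut])
  have hf' := directionalLimits_subset u c hf
  have hg' := directionalLimits_subset u c hg
  set r := det u v + det u t with hr
  set e : ℤ × ℤ → ℤ := fun x => f x - g x with he
  have he0 : diffBy t (diffBy v e) = fun _ => 0 := by
    rw [diffBy_comm]
    have h1 := diffList_sub [v, t] f g
    rw [diffList_of_mem_directionalLimits h.1.2 hf, diffList_of_mem_directionalLimits h.1.2 hg]
      at h1
    simp only [sub_self] at h1
    exact h1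
  have hestrip : ∀ x, 0 ≤ det u x → det u x < r → dotHom u x < 0 → e x = 0 :=
    fun x h1 h2 h3 => sub_eq_zero.2 (hfg x h1 h2 h3)
  by_cases hβ : diffBy v e = fun _ => 0
  · exact h.false_of_periodic_sub hc hP huv (by omega) hf hg hfg
      (let ⟨x, _, hx⟩ := hne; ⟨x, hx⟩) (diffBy_eq_zero_iff.1 hβ)
  have hper := diffBy_eq_zero_iff.1 he0
  -- The margins `det u v` in thickness and `|dotHom u v|` in height keep both `x` and `x + v` in
  -- the half-strip where `e` vanishes.
  obtain ⟨C, hC, x₀, hx₀, hex₀⟩ := exists_leftmost_line hu hut (r := det u t)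
    (t := -|dotHom u v|) le_rfl hper (fun x h1 h2 h3 => by
      have h4 := neg_abs_le (dotHom u v)
      have h5 := le_abs_self (dotHom u v)
      have h6 := abs_nonneg (dotHom u v)
      simp only [diffBy]
      rw [hestrip x h1 (by omega) (by omega), hestrip (x + v) (by rw [det_add_right]; omega)
        (by rw [det_add_right]; omega) (by rw [map_add]; omega), sub_zero])
    (by
      by_contra! hcon
      exact hβ (funext hcon))
  obtain ⟨b, hb⟩ := exists_strip_bound hu hut r 0
  have hback : ∀ x, det x t < C + det v t → ∀ j : ℕ, e (x + (-(j : ℤ)) • v) = e x := by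
    intro x hx j
    induction j with
    | zero => simp
    | succ j ih =>
      rw [← ih]
      have h1 := hC (x + (-((j + 1 : ℕ) : ℤ)) • v) (by
        rw [det_add_smul_left]
        push_cast
        have : 0 ≤ (j : ℤ) * det v t := by positivity
        linarith)
      simp only [diffBy] at h1
      rw [← sub_eq_zero.1 h1]
      congr 1
      push_cast
      module
  set K := (C + det v t - b).toNat with hK
  -- Backward steps along `v` preserve `e` and reach the half-strip; `K` steps are enough to bring
  -- `det · t` down to `b`.
  have hsector : ∀ x, det x t < C + det v t → K * det u v ≤ det u x → e x = 0 := by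
    intro x hx1 hx2
    have e1 := Int.emod_add_mul_ediv (det u x) (det u v)
    have e2 := Int.emod_nonneg (det u x) huv.ne'
    have e3 := Int.emod_lt_of_pos (det u x) huv
    have e4 : (K : ℤ) ≤ det u x / det u v := (Int.le_ediv_iff_mul_le huv).2 hx2
    obtain ⟨k, hk⟩ := Int.eq_ofNat_of_zero_le (le_trans (Int.natCast_nonneg K) e4)
    rw [hk] at e1 e4
    rw [← hback x hx1 k]
    have h1 : 0 ≤ det u (x + (-(k : ℤ)) • v) := by rw [det_add_smul_right]; linarith
    have h2 : det u (x + (-(k : ℤ)) • v) < r := by rw [det_add_smul_right]; linarith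
    refine hestrip _ h1 h2 (hb _ h1 h2 ?_)
    rw [det_add_smul_left]
    have h3 : (k : ℤ) * 1 ≤ k * det v t := mul_le_mul_of_nonneg_left hvt (by omega)
    have h4 : C + det v t - b ≤ K := Int.self_le_toNat _
    linarith
  set h₁ := K * det u v + det u v with hh₁
  have hline : ∀ x, det x t = C + det v t → h₁ ≤ det u x → e x = diffBy v e (x - v) := by
    intro x hx1 hx2
    have h1 := hsector (x - v) (by rw [det_sub_left]; omega) (by rw [det_sub_right]; omega)
    simp only [diffBy]
    rw [h1, sub_add_cancel, sub_zero]
  obtain ⟨M, hM, hray⟩ := exists_ray hc hP (ht.hasFaces hc) (detHom u) hut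
    (det u t + det v t).toNat
  obtain ⟨κ, hκ⟩ := hray f hf' g hg' (C + det v t)
  have hthick : ∀ x, C + det v t - (det u t + det v t) ≤ det x t → det x t < C + det v t →
      h₁ + κ ≤ det u x → diffBy ((M : ℤ) • t) f x = 0 := by
    intro x hx1 hx2 hx3
    refine sub_eq_zero.2 (hκ h₁ (fun y hy1 hy2 => ?_) (fun y hy1 hy2 => ?_) ?_ x (by omega) hx2 hx3)
    · rw [detHom_apply] at hy2
      exact sub_eq_zero.1 (hsector y hy1 (by omega))
    · rw [detHom_apply] at hy2
      show e (y + t) = e y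
      rw [hline y hy1 hy2, hline (y + t) (by rw [det_add_left, det_self, add_zero, hy1])
        (by rw [det_add_right]; omega), add_sub_right_comm, hper]
    · have h1 : det (x₀ + ((h₁ - det u x₀).toNat : ℤ) • t + v) t = C + det v t := by
        rw [det_add_left, det_add_smul_left, det_self, hx₀]; ring
      have h2 : h₁ ≤ det u (x₀ + ((h₁ - det u x₀).toNat : ℤ) • t + v) := by
        rw [det_add_right, det_add_smul_right]
        have h2 : ((h₁ - det u x₀).toNat : ℤ) * 1 ≤ ((h₁ - det u x₀).toNat : ℤ) * det u t :=
          mul_le_mul_of_nonneg_left (by omega) (by omega)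
        omega
      refine ⟨_, h1, h2, ?_⟩
      rw [← sub_ne_zero]
      refine (hline _ h1 h2).trans_ne ?_
      rw [add_sub_cancel_right, periodic_zsmul hper]
      exact hex₀
  have hhalf := eq_zero_on_sector huv hut hvt (G := diffBy ((M : ℤ) • t) f) (by
    refine Eq.trans (diffList_diffBy ((M : ℤ) • t) [u, v] f) ?_
    exact diffBy_zsmul_eq_zero (diffList_of_mem_limits hf' ht.1.2) M) hthick
  -- Translating by large multiples of `-u` moves every point with `det u x` large into the sector,
  -- so `f'` is `M • t`-periodic on a half-plane.
  obtain ⟨f', hf'u, hlim⟩ := exists_directionalLimit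
    (hc.subset (Set.range_subset_iff.2 (range_subset_of_mem_limits hf'))) u
  have hf'c := limits_trans hf' (directionalLimits_subset u f hf'u)
  have hper' : ∀ x, h₁ + κ ≤ det u x → f' (x + (M : ℤ) • t) = f' x := by
    intro x hx
    obtain ⟨k, hk, hk'⟩ := hlim {x, x + (M : ℤ) • t} (det x t - C - det v t + 1).toNat
    rw [hk' x (by simp), hk' (x + (M : ℤ) • t) (by simp), add_right_comm]
    refine sub_eq_zero.1 (hhalf (x + (-(k : ℤ)) • u) ?_ ?_)
    · rw [det_add_smul_left]
      have h1 : (k : ℤ) * 1 ≤ k * det u t := mul_le_mul_of_nonneg_left hut (by omega)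
      have h2 : det x t - C - det v t + 1 ≤ (k : ℤ) := by omega
      linarith
    · rw [det_add_smul_right, det_self]
      linarith
  obtain ⟨ρ, hexp⟩ := hexp
  -- A shift by `j • v` places the determining strip of `u` inside that half-plane.
  set j : ℤ := ((h₁ + κ + ρ).toNat : ℤ) with hj
  have hj1 : j * 1 ≤ j * det u v := mul_le_mul_of_nonneg_left huv (by omega)
  have hall := hexp _ (mem_limits_translate hf'c (j • v + (M : ℤ) • t)) _
    (mem_limits_translate hf'c (j • v)) (fun x hx => by
      rw [← add_assoc]
      apply hper'
      rw [det_add_smul_right]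
      have := abs_le.1 hx
      omega)
  have hzero : diffBy ((M : ℤ) • t) f' = fun _ => 0 := by
    funext x
    have h1 := congrFun hall (x - j • v)
    rw [← add_assoc, sub_add_cancel] at h1
    exact sub_eq_zero.2 h1
  have hfin : diffList [v, t] f' = diffList [v, t] c := by
    rw [diffList_of_mem_directionalLimits (diffList_of_mem_limits hf' h.1.2) hf'u,
      diffList_of_mem_directionalLimits h.1.2 hf]
  refine (h.perm ((List.Perm.swap t v []).cons u)).not_periodic hc (M := M)
    (by exact_mod_cast hM.ne') ?_
  rw [diffList_perm (List.Perm.swap v t []), ← hfin, ← diffList_diffBy, hzero]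
  exact diffList_zero _

/-! ### At most three annihilating directions. -/

theorem MinAnnihilates.hasFaces_of_mem {c : ℤ × ℤ → ℤ} (hc : (Set.range c).Finite)
    {J : List (ℤ × ℤ)} (h : MinAnnihilates J c) (hJ : 2 ≤ J.length) {u : ℤ × ℤ} (hu : u ∈ J) :
    HasFaces c u ∧ HasFaces c (-u) := by
  have h1 := h.perm (List.perm_cons_erase hu)
  have h2 := List.length_erase_of_mem hu
  obtain ⟨v, L, hL⟩ := List.exists_cons_of_length_pos (l := J.erase u) (by omega)
  rw [hL] at h1
  exact ⟨h1.hasFaces hc, h1.neg_cons.hasFaces hc⟩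

/-- Two left edges with the same lowest row are parallel. -/
theorem det_eq_zero_of_faces {S : Set (ℤ × ℤ)} {u u' p q p' q' : ℤ × ℤ} (hu : 0 < u.2)
    (hu' : 0 < u'.2) (hp : p ∈ S) (hq : q ∈ S) (hp' : p' ∈ S) (hq' : q' ∈ S)
    (hpq : p.2 < q.2) (hpq' : p'.2 < q'.2) (h : det p u = det q u) (h' : det p' u' = det q' u')
    (hmin : ∀ w ∈ S, det p u ≤ det w u) (hmin' : ∀ w ∈ S, det p' u' ≤ det w u')
    (hrow : p.2 = p'.2) : det u u' = 0 := by
  have h1 := hmin p' hp'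
  have h2 := hmin' p hp
  have h3 := hmin q' hq'
  have h4 := hmin' q hq
  simp only [det] at *
  rw [← hrow] at h1 h2 h' hpq' h4
  have h5 : p.1 = p'.1 := by
    apply le_antisymm
    · exact le_of_mul_le_mul_right (by linarith) hu
    · exact le_of_mul_le_mul_right (by linarith) hu'
  rw [← h5] at h' h4
  set s := q.2 - p.2 with hs
  set s' := q'.2 - p.2 with hs'
  have e1 : (q.1 - p.1) * u.2 = s * u.1 := by rw [hs]; linarith
  have e2 : (q'.1 - p.1) * u'.2 = s' * u'.1 := by rw [hs']; linarith
  have e3 : 0 ≤ (q'.1 - p.1) * u.2 - s' * u.1 := by rw [hs']; linarith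
  have e4 : 0 ≤ (q.1 - p.1) * u'.2 - s * u'.1 := by rw [hs]; linarith
  have e5 : 0 ≤ s' * (u.2 * u'.1 - u'.2 * u.1) := by
    have := mul_nonneg e3 hu'.le
    linear_combination this + u.2 * e2
  have e6 : 0 ≤ s * (u'.2 * u.1 - u.2 * u'.1) := by
    have := mul_nonneg e4 hu.le
    linear_combination this + u'.2 * e1
  have e7 := nonneg_of_mul_nonneg_right e5 (by omega)
  have e8 := nonneg_of_mul_nonneg_right e6 (by omega)
  linarith

/-- In three rows there are no three pairwise nonparallel left edges. -/
theorem false_of_three_faces {n : ℕ} {F : ℤ × ℤ → ℤ} {d : Fin 3 → ℤ × ℤ}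
    (hd : ∀ i j, i ≠ j → det (d i) (d j) ≠ 0) (h0 : ∀ i, (d i).2 ≠ 0)
    (h : ∀ i, ∀ u, u = d i ∨ u = - d i → ∃ p ∈ rectangle n 3, ∃ q ∈ rectangle n 3, p ≠ q ∧
      F p ≠ 0 ∧ F q ≠ 0 ∧ det p u = det q u ∧
      ∀ w ∈ rectangle n 3, F w ≠ 0 → det p u ≤ det w u) : False := by
  have key : ∀ i, ∃ u p q : ℤ × ℤ, (u = d i ∨ u = - d i) ∧ 0 < u.2 ∧
      (p ∈ rectangle n 3 ∧ F p ≠ 0) ∧ (q ∈ rectangle n 3 ∧ F q ≠ 0) ∧ p.2 < q.2 ∧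
      det p u = det q u ∧ ∀ w, w ∈ rectangle n 3 ∧ F w ≠ 0 → det p u ≤ det w u := by
    intro i
    -- For an upward `u`, minimizing `det · u` selects a left edge. Its lower endpoint lies in row 0
    -- or 1, and nonparallel edges cannot share that row.
    obtain ⟨u, hu, hpos⟩ : ∃ u, (u = d i ∨ u = - d i) ∧ 0 < u.2 := by
      rcases lt_or_gt_of_ne (h0 i) with hneg | hpos
      · exact ⟨_, Or.inr rfl, by simpa using hneg⟩
      · exact ⟨_, Or.inl rfl, hpos⟩
    obtain ⟨p, hp, q, hq, hpq, hFp, hFq, hdet, hmin⟩ := h i u hu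
    rcases lt_trichotomy p.2 q.2 with hlt | heq | hlt
    · exact ⟨u, p, q, hu, hpos, ⟨hp, hFp⟩, ⟨hq, hFq⟩, hlt, hdet, fun w hw => hmin w hw.1 hw.2⟩
    · exfalso
      apply hpq
      refine Prod.ext ?_ heq
      simp only [det, heq] at hdet
      exact mul_right_cancel₀ hpos.ne' (by linarith : p.1 * u.2 = q.1 * u.2)
    · exact ⟨u, q, p, hu, hpos, ⟨hq, hFq⟩, ⟨hp, hFp⟩, hlt, hdet.symm,
        fun w hw => hdet ▸ hmin w hw.1 hw.2⟩
  choose u p q hu hpos hp hq hpq hdet hmin using key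
  have hpair : ∀ i j, i ≠ j → (p i).2 ≠ (p j).2 := by
    intro i j hij hrow
    have h1 := det_eq_zero_of_faces (S := {w | w ∈ rectangle n 3 ∧ F w ≠ 0}) (hpos i) (hpos j)
      (hp i) (hq i) (hp j) (hq j) (hpq i) (hpq j) (hdet i) (hdet j) (hmin i) (hmin j) hrow
    apply hd i j hij
    rcases hu i with h2 | h2 <;> rcases hu j with h3 | h3 <;> rw [h2, h3] at h1 <;>
      simpa only [det_neg_left, det_neg_right, neg_neg, neg_eq_zero] using h1
  have hrow : ∀ i, 0 ≤ (p i).2 ∧ (p i).2 < 2 := by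
    intro i
    have h1 := mem_rectangle.1 (hp i).1
    have h2 := mem_rectangle.1 (hq i).1
    have h3 := hpq i
    push_cast at h1 h2
    omega
  have h1 := hpair 0 1 (by decide)
  have h2 := hpair 0 2 (by decide)
  have h3 := hpair 1 2 (by decide)
  have h4 := hrow 0
  have h5 := hrow 1
  have h6 := hrow 2
  omega

/-- Of four pairwise nonparallel vectors at most one is horizontal; the other three contradict
`false_of_three_faces`. -/
theorem MinAnnihilates.length_le_three {c : ℤ × ℤ → ℤ} (hc : (Set.range c).Finite) {n : ℕ}
    (hP : complexity c (rectangle n 3) ≤ n * 3) {J : List (ℤ × ℤ)} (h : MinAnnihilates J c) :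
    J.length ≤ 3 := by
  by_contra! hlen
  obtain ⟨F, K, hF, hrel⟩ := exists_relation hc (B := rectangle n 3)
    (by rwa [card_rectangle])
  match J, hlen with
  | u₁ :: u₂ :: u₃ :: u₄ :: L, _ =>
    have hface : ∀ u ∈ u₁ :: u₂ :: u₃ :: u₄ :: L, HasFaces c u ∧ HasFaces c (-u) :=
      fun u hu => h.hasFaces_of_mem hc (by simp) hu
    have h12 : det u₁ u₂ ≠ 0 := h.det_ne_zero_of_mem hc (by simp)
    have h13 : det u₁ u₃ ≠ 0 := h.det_ne_zero_of_mem hc (by simp)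
    have h14 : det u₁ u₄ ≠ 0 := h.det_ne_zero_of_mem hc (by simp)
    have h' := h.perm (List.Perm.swap _ _ _)
    have h23 : det u₂ u₃ ≠ 0 := h'.det_ne_zero_of_mem hc (by simp)
    have h24 : det u₂ u₄ ≠ 0 := h'.det_ne_zero_of_mem hc (by simp)
    have h34 : det u₃ u₄ ≠ 0 := (h.perm (((List.Perm.swap u₃ u₂ _).cons u₁).trans
      (List.Perm.swap u₃ u₁ _))).det_ne_zero_of_mem hc (by simp)
    have key : ∀ a b d : ℤ × ℤ, (a ∈ u₁ :: u₂ :: u₃ :: u₄ :: L) →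
        (b ∈ u₁ :: u₂ :: u₃ :: u₄ :: L) → (d ∈ u₁ :: u₂ :: u₃ :: u₄ :: L) → det a b ≠ 0 →
        det a d ≠ 0 → det b d ≠ 0 → a.2 ≠ 0 → b.2 ≠ 0 → d.2 ≠ 0 → False := by
      intro a b d ha hb hd hab had hbd ha2 hb2 hd2
      refine false_of_three_faces (n := n) (F := F) (d := ![a, b, d]) ?_ ?_ ?_
      · intro i j hij
        fin_cases i <;> fin_cases j <;>
          first
          | exact absurd rfl hij
          | assumption
          | (rw [det_swap, neg_ne_zero]; assumption)
      · intro i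
        fin_cases i <;> assumption
      · intro i u hu
        have hi : ![a, b, d] i ∈ u₁ :: u₂ :: u₃ :: u₄ :: L := by fin_cases i <;> assumption
        rcases hu with rfl | rfl
        · exact (hface _ hi).1 _ F K hrel hF
        · exact (hface _ hi).2 _ F K hrel hF
    have hor : ∀ a b : ℤ × ℤ, det a b ≠ 0 → a.2 = 0 → b.2 ≠ 0 := by
      intro a b hab ha hb
      apply hab
      simp [det, ha, hb]
    by_cases a1 : u₁.2 = 0
    · exact key u₂ u₃ u₄ (by simp) (by simp) (by simp) h23 h24 h34 (hor _ _ h12 a1)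
        (hor _ _ h13 a1) (hor _ _ h14 a1)
    by_cases a2 : u₂.2 = 0
    · exact key u₁ u₃ u₄ (by simp) (by simp) (by simp) h13 h14 h34 a1
        (hor _ _ h23 a2) (hor _ _ h24 a2)
    by_cases a3 : u₃.2 = 0
    · exact key u₁ u₂ u₄ (by simp) (by simp) (by simp) h12 h14 h24 a1 a2 (hor _ _ h34 a3)
    · exact key u₁ u₂ u₃ (by simp) (by simp) (by simp) h12 h13 h23 a1 a2 a3

/-- A configuration of low complexity is periodic, or it has three pairwise nonparallel directions
none of which is expansive. -/
theorem periodic_or_three_directions {c : ℤ × ℤ → ℤ} (hc : (Set.range c).Finite) {n : ℕ}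
    (hP : complexity c (rectangle n 3) ≤ n * 3) :
    (∃ u : ℤ × ℤ, u ≠ 0 ∧ ∀ x, c (x + u) = c x) ∨
      ∃ d : Fin 3 → ℤ × ℤ, (∀ i j, i ≠ j → det (d i) (d j) ≠ 0) ∧ ∀ i, ¬ IsExpansive (d i) c := by
  obtain ⟨F, K, ⟨v₀, hv₀, hF⟩, hrel⟩ := exists_relation hc (B := rectangle n 3)
    (by rwa [card_rectangle])
  obtain ⟨J, hJ⟩ := exists_minAnnihilates (exists_annihilates_of_relation hc hv₀ hF hrel)
  have hlen := hJ.length_le_three hc hP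
  match J, hlen with
  | [], _ =>
    have h1 : c = fun _ => 0 := hJ.1.2
    exact Or.inl ⟨(1, 0), by simp, fun x => by rw [h1]⟩
  | [u], _ => exact Or.inl ⟨u, hJ.1.1 u (by simp), diffBy_eq_zero_iff.1 hJ.1.2⟩
  | [u, v], _ => exact absurd hJ (not_minAnnihilates_pair hc hP)
  | [a, b, d], _ =>
    have key : ∀ a b d : ℤ × ℤ, MinAnnihilates [a, b, d] c → ¬ IsExpansive a c := by
      intro a b d hJ hexp
      wlog hb : 0 < det a b generalizing b
      · refine this (-b) ((hJ.perm (List.Perm.swap b a [d])).neg_cons.perm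
          (List.Perm.swap a (-b) [d])) ?_
        have : det a b ≠ 0 := hJ.det_ne_zero_of_mem hc (by simp)
        rw [det_neg_right]
        omega
      wlog hd : 0 < det a d generalizing d
      · refine this (-d) ?_ ?_
        · have h1 : [a, b, d].Perm [d, a, b] :=
            ((List.Perm.swap d b []).cons a).trans (List.Perm.swap d a [b])
          have h2 : [-d, a, b].Perm [a, b, -d] :=
            (List.Perm.swap a (-d) [b]).trans ((List.Perm.swap b (-d) []).cons a)
          exact (hJ.perm h1).neg_cons.perm h2
        · have : det a d ≠ 0 := hJ.det_ne_zero_of_mem hc (by simp)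
          rw [det_neg_right]
          omega
      have hbd : det b d ≠ 0 :=
        (hJ.perm (List.Perm.swap b a [d])).det_ne_zero_of_mem hc (by simp)
      rcases lt_or_gt_of_ne hbd with hneg | hpos
      · refine not_minAnnihilates_of_isExpansive hc hP hexp hd hb ?_
          (hJ.perm ((List.Perm.swap d b []).cons a))
        rw [det_swap]
        omega
      · exact not_minAnnihilates_of_isExpansive hc hP hexp hb hd hpos hJ
    have hab : det a b ≠ 0 := hJ.det_ne_zero_of_mem hc (by simp)
    have had : det a d ≠ 0 := hJ.det_ne_zero_of_mem hc (by simp)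
    have h' := hJ.perm (List.Perm.swap b a [d])
    have hbd : det b d ≠ 0 := h'.det_ne_zero_of_mem hc (by simp)
    refine Or.inr ⟨![a, b, d], fun i j hij => ?_, fun i => ?_⟩
    · fin_cases i <;> fin_cases j <;>
        first
        | exact absurd rfl hij
        | assumption
        | (rw [det_swap, neg_ne_zero]; assumption)
    · fin_cases i
      · exact key a b d hJ
      · exact key b a d h'
      · exact key d a b (hJ.perm (((List.Perm.swap d b []).cons a).trans
          (List.Perm.swap d a [b])))

/-! ### From integer configurations to orbit closures and Euclidean lines. -/

theorem mem_orbitClosure_iff {A : Type*} [TopologicalSpace A] [DiscreteTopology A]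
    {η f : ℤ × ℤ → A} :
    f ∈ orbitClosure η ↔ ∀ B : Finset (ℤ × ℤ), ∃ u : ℤ × ℤ, ∀ x ∈ B, f x = η (x + u) := by
  rw [orbitClosure, mem_closure_iff]
  constructor
  · intro h B
    obtain ⟨_, hg, u, rfl⟩ := h ((B : Set (ℤ × ℤ)).pi fun x => {f x})
      (isOpen_set_pi B.finite_toSet fun x _ => isOpen_discrete _) (fun x _ => rfl)
    exact ⟨u, fun x hx => (hg x hx).symm⟩
  · intro h o ho hfo
    obtain ⟨B, s, hs, hsub⟩ := isOpen_pi_iff.1 ho f hfo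
    obtain ⟨u, hu⟩ := h B
    refine ⟨translate u η, hsub fun x hx => ?_, u, rfl⟩
    show η (x + u) ∈ s x
    rw [← hu x hx]
    exact (hs x hx).2

theorem comp_mem_limits_iff {A : Type*} [TopologicalSpace A] [DiscreteTopology A] {φ : A → ℤ}
    (hφ : φ.Injective) {η f : ℤ × ℤ → A} : φ ∘ f ∈ limits (φ ∘ η) ↔ f ∈ orbitClosure η := by
  rw [mem_orbitClosure_iff]
  exact forall_congr' fun B => exists_congr fun u => forall₂_congr fun x _ => hφ.eq_iff

theorem complexity_comp {A : Type*} {φ : A → ℤ} (hφ : φ.Injective) (η : ℤ × ℤ → A)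
    (S : Finset (ℤ × ℤ)) : complexity (φ ∘ η) S = complexity η S := by
  have h : words (φ ∘ η) S = (fun w : S → A => φ ∘ w) '' words η S := by
    rw [words, words, ← Set.range_comp]
    rfl
  rw [complexity, complexity, h]
  exact Set.ncard_image_of_injective _ hφ.comp_left

/-- The line through the origin spanned by `u`. -/
noncomputable def lineThrough (u : ℤ × ℤ) : AffineSubspace ℝ Plane :=
  (Submodule.span ℝ {toPlane u}).toAffineSubspace

theorem toPlane_ne_zero {u : ℤ × ℤ} (hu : u ≠ 0) : toPlane u ≠ 0 := by
  intro h
  apply hu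
  have h0 := congrArg (fun y : Plane => y 0) h
  have h1 := congrArg (fun y : Plane => y 1) h
  simp only [toPlane] at h0 h1
  exact Prod.ext (by simpa using h0) (by simpa using h1)

theorem toPlane_add_smul (x u : ℤ × ℤ) (k : ℤ) :
    toPlane (x + k • u) = toPlane x + (k : ℝ) • toPlane u := by
  ext i
  fin_cases i <;> simp [toPlane]

theorem zero_mem_lineThrough (u : ℤ × ℤ) : (0 : Plane) ∈ lineThrough u :=
  Submodule.zero_mem _

theorem isLine_lineThrough {u : ℤ × ℤ} (hu : u ≠ 0) : IsLine (lineThrough u) := by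
  refine ⟨⟨0, zero_mem_lineThrough u⟩, ?_⟩
  rw [lineThrough, Submodule.toAffineSubspace_direction]
  exact finrank_span_singleton (toPlane_ne_zero hu)

theorem det_eq_zero_of_lineThrough_eq {u v : ℤ × ℤ} (h : lineThrough u = lineThrough v) :
    det u v = 0 := by
  have h1 : toPlane v ∈ lineThrough u := by
    rw [h]
    exact Submodule.mem_span_singleton_self _
  obtain ⟨a, ha⟩ := Submodule.mem_span_singleton.1 h1
  have h2 := congrArg (fun y : Plane => y 0) ha
  have h3 := congrArg (fun y : Plane => y 1) ha
  simp [toPlane] at h2 h3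
  have h4 : ((det u v : ℤ) : ℝ) = 0 := by
    simp only [det]
    push_cast
    rw [← h2, ← h3]
    ring
  exact_mod_cast h4

theorem abs_det_le_of_infDist_lt {u x : ℤ × ℤ} {r : ℝ}
    (h : Metric.infDist (toPlane x) (lineThrough u : Set Plane) < r) :
    |((det u x : ℤ) : ℝ)| ≤ (|(u.1 : ℝ)| + |(u.2 : ℝ)|) * r := by
  obtain ⟨y, hy, hd⟩ := (Metric.infDist_lt_iff ⟨0, zero_mem_lineThrough u⟩).1 h
  obtain ⟨a, rfl⟩ := Submodule.mem_span_singleton.1 hy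
  rw [dist_eq_norm] at hd
  have h0 := (PiLp.norm_apply_le (toPlane x - a • toPlane u) 0).trans hd.le
  have h1 := (PiLp.norm_apply_le (toPlane x - a • toPlane u) 1).trans hd.le
  simp [toPlane] at h0 h1
  have h2 : ((det u x : ℤ) : ℝ) = u.1 * (x.2 - a * u.2) - u.2 * (x.1 - a * u.1) := by
    simp only [det]
    push_cast
    ring
  rw [h2, add_mul]
  refine (abs_sub _ _).trans (add_le_add ?_ ?_)
  · rw [abs_mul]
    exact mul_le_mul_of_nonneg_left h1 (abs_nonneg _)
  · rw [abs_mul]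
    exact mul_le_mul_of_nonneg_left h0 (abs_nonneg _)

theorem isNonexpansiveLine_of_not_isExpansive {A : Type*} [TopologicalSpace A]
    [DiscreteTopology A] {φ : A → ℤ} (hφ : φ.Injective) {η : ℤ × ℤ → A} {u : ℤ × ℤ} (hu : u ≠ 0)
    (h : ¬ IsExpansive u (φ ∘ η)) : IsNonexpansiveLine η (lineThrough u) := by
  refine ⟨isLine_lineThrough hu, fun r => ?_⟩
  have hlift : ∀ f ∈ limits (φ ∘ η), ∃ f', φ ∘ f' = f := by
    intro f hf
    choose f' hf' using fun x => range_subset_of_mem_limits hf x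
    exact ⟨fun x => η (f' x), funext hf'⟩
  by_contra! hcon
  refine h ⟨⌈(|(u.1 : ℝ)| + |(u.2 : ℝ)|) * r⌉, fun f hf g hg hfg => ?_⟩
  obtain ⟨f, rfl⟩ := hlift f hf
  obtain ⟨g, rfl⟩ := hlift g hg
  rw [comp_mem_limits_iff hφ] at hf hg
  by_contra hne
  obtain ⟨x, hx, hxne⟩ := hcon f hf g hg (fun h => hne (by rw [h]))
  refine hxne (hφ (hfg x ?_))
  have h1 := (abs_det_le_of_infDist_lt hx).trans (Int.le_ceil _)
  exact_mod_cast h1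

/-- Write `x` as a point of `l` plus `t` times `u`; subtracting the integer part of `t` leaves less
than one step of `u`. -/
theorem exists_infDist_le {l : AffineSubspace ℝ Plane} (hl : IsLine l) (h0 : (0 : Plane) ∈ l)
    {u : ℤ × ℤ} (hu : toPlane u ∉ l.direction) (x : ℤ × ℤ) :
    ∃ k : ℤ, Metric.infDist (toPlane (x + k • u)) (l : Set Plane) ≤ ‖toPlane u‖ := by
  have hlt : l.direction < l.direction ⊔ Submodule.span ℝ {toPlane u} :=
    left_lt_sup.2 fun h => hu (h (Submodule.mem_span_singleton_self _))
  have htop : l.direction ⊔ Submodule.span ℝ {toPlane u} = ⊤ := by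
    apply Submodule.eq_top_of_finrank_eq
    have h1 := Submodule.finrank_lt_finrank_of_lt hlt
    have h2 := Submodule.finrank_le (l.direction ⊔ Submodule.span ℝ {toPlane u})
    have h3 := hl.2
    have h4 : Module.finrank ℝ Plane = 2 := finrank_euclideanSpace_fin
    omega
  obtain ⟨w, hw, v, hv, hwv⟩ := Submodule.mem_sup.1 (htop ▸ Submodule.mem_top : toPlane x ∈ _)
  obtain ⟨t, rfl⟩ := Submodule.mem_span_singleton.1 hv
  have hwl : w ∈ l := by
    have := AffineSubspace.vadd_mem_of_mem_direction hw h0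
    simpa using this
  refine ⟨-⌊t⌋, (Metric.infDist_le_dist_of_mem hwl).trans ?_⟩
  rw [dist_eq_norm, toPlane_add_smul, ← hwv]
  have h1 : w + t • toPlane u + ((-⌊t⌋ : ℤ) : ℝ) • toPlane u - w = Int.fract t • toPlane u := by
    rw [Int.fract]
    push_cast
    module
  rw [h1, norm_smul, Real.norm_eq_abs, Int.abs_fract]
  exact mul_le_of_le_one_left (norm_nonneg _) (Int.fract_lt_one t).le

/-- The period passes to the orbit closure, and along a line transversal to `u` a neighbourhood of
width `‖toPlane u‖ + 1` contains a representative of every point modulo `u`. -/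
theorem nonexpansiveLines_subset_of_periodic {A : Type*} [TopologicalSpace A]
    [DiscreteTopology A] {η : ℤ × ℤ → A} {u : ℤ × ℤ} (hu : u ≠ 0) (hper : ∀ x, η (x + u) = η x) :
    nonexpansiveLines η ⊆ {lineThrough u} := by
  rintro l ⟨⟨hl, hne⟩, h0⟩
  have hper' : ∀ f ∈ orbitClosure η, ∀ (k : ℤ) x, f (x + k • u) = f x := by
    intro f hf
    have h1 : ∀ x, f (x + u) = f x := by
      intro x
      obtain ⟨v, hv⟩ := mem_orbitClosure_iff.1 hf {x, x + u}
      rw [hv x (by simp), hv (x + u) (by simp), add_right_comm, hper]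
    intro k
    induction k using Int.induction_on with
    | zero => simp
    | succ k ih => intro x; rw [add_smul, one_smul, ← add_assoc, h1, ih]
    | pred k ih => intro x; rw [← h1, sub_smul, one_smul, add_assoc, sub_add_cancel, ih]
  by_cases hmem : toPlane u ∈ l.direction
  · refine AffineSubspace.ext_of_direction_eq ?_ ⟨0, h0, zero_mem_lineThrough u⟩
    rw [lineThrough, Submodule.toAffineSubspace_direction]
    symm
    refine Submodule.eq_of_le_of_finrank_eq ?_ ?_
    · rwa [Submodule.span_singleton_le_iff_mem]
    · rw [hl.2]
      exact finrank_span_singleton (toPlane_ne_zero hu)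
  · exfalso
    obtain ⟨f, hf, g, hg, hfg, hagree⟩ := hne (‖toPlane u‖ + 1)
    refine hfg (funext fun x => ?_)
    obtain ⟨k, hk⟩ := exists_infDist_le hl h0 hmem x
    rw [← hper' f hf k x, ← hper' g hg k x]
    exact hagree _ (by linarith)

end Nivat

/-! ### Counting nonexpansive lines: at most one, or at least three. -/

theorem mainTheorem4 {A : Type*} [Finite A] [TopologicalSpace A] [DiscreteTopology A]
    (η : ℤ × ℤ → A) (hη : (Nivat.nonexpansiveLines η).encard = 2) :
    ∀ n : ℕ, 3 * n < Nivat.complexity η (Nivat.rectangle n 3) := by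
  intro n
  by_contra! hP
  obtain ⟨ψ, hψ⟩ := exists_injective_nat A
  set φ : A → ℤ := fun a => (ψ a : ℤ) with hφ
  have hinj : φ.Injective := Nat.cast_injective.comp hψ
  have hc : (Set.range (φ ∘ η)).Finite :=
    (Set.finite_range φ).subset (Set.range_comp_subset_range η φ)
  rcases Nivat.periodic_or_three_directions hc (n := n)
    (by rw [Nivat.complexity_comp hinj]; omega) with ⟨u, hu, hper⟩ | ⟨d, hd, hexp⟩
  · have h1 := Set.encard_le_encard
      (Nivat.nonexpansiveLines_subset_of_periodic hu fun x => hinj (hper x))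
    rw [hη, Set.encard_singleton] at h1
    exact absurd h1 (by decide)
  · have hd0 : ∀ i, d i ≠ 0 := by
      intro i h0
      obtain ⟨j, hj⟩ := exists_ne i
      apply hd j i hj
      rw [h0]
      simp [Nivat.det]
    have hline : Function.Injective fun i => Nivat.lineThrough (d i) := by
      intro i j hij
      by_contra hne
      exact hd i j hne (Nivat.det_eq_zero_of_lineThrough_eq hij)
    have h1 : Set.range (fun i => Nivat.lineThrough (d i)) ⊆ Nivat.nonexpansiveLines η := by
      rintro _ ⟨i, rfl⟩
      exact ⟨Nivat.isNonexpansiveLine_of_not_isExpansive hinj (hd0 i) (hexp i),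
        Nivat.zero_mem_lineThrough _⟩
    have h2 := hline.encard_range.trans (Set.encard_le_encard h1)
    rw [hη, ENat.card_eq_coe_fintype_card, Fintype.card_fin] at h2
    exact absurd h2 (by decide)
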